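/- Let $H\in(0,1)$, let $d\in\mathbb N$ with $d>1/H$, and let $x\in\mathbb R^d$. Let $B^H=\{B^H(t),\,t\ge 0\}$ be a $d$-dimensional fractional Brownian motion with Hurst parameter $H$, that is, its coordinates $B^H_1,\dots,B^H_d$ are independent centred Gaussian processes with almost surely continuous paths and covariance $$E[B_i^H(t)B_i^H(s)]=\tfrac12\bigl(t^{2H}+s^{2H}-|t-s|^{2H}\bigr),\qquad s,t\ge 0.$$ Then for every continuous, bounded and Lebesgue integrable function $f:\mathbb R^d\to\mathbb R$ the perpetual integral functional $\int_0^\infty f(x+B^H(t))\,dt$ exists almost surely (as an absolutely convergent integral), it is integrable, and $$E\left[\int_0^\infty f(x+B^H(t))\,dt\right]=C_{d,H}\int_{\mathbb R^d}\frac{f(x+y)}{|y|^{d-1/H}}\,dy,$$ where the integral on the right-hand side converges absolutely and $$C_{d,H}=2^{-(1+1/(2H))}\,H^{-1}\,\pi^{-d/2}\,\Gamma\!\left(\frac d2-\frac1{2H}\right).$$ If moreover $f\not\equiv 0$, then $\int_0^\infty f(x+B^H(t))\,dt$ is a non-constant random variable (it is not almost surely equal to a constant), and its variance is finite and strictly positive.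 -/

import Mathlib

open MeasureTheory ProbabilityTheory Set
open scoped NNReal

/-- `X` is a one-dimensional fractional Brownian motion with Hurst parameter `H` under `P`:
a centred Gaussian process on `[0, ∞)` with covariance
`E[X t * X s] = (t^(2H) + s^(2H) - |t - s|^(2H)) / 2` and almost surely continuous paths. -/
structure IsFractionalBrownianReal {Ω : Type*} [MeasurableSpace Ω] (H : ℝ)
    (X : ℝ≥0 → Ω → ℝ) (P : Measure Ω) : Prop where
  isGaussianProcess : IsGaussianProcess X P
  mean_zero : ∀ t : ℝ≥0, ∫ ω, X t ω ∂P = 0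
  covariance : ∀ t s : ℝ≥0, ∫ ω, X t ω * X s ω ∂P =
    (1 / 2 : ℝ) * ((t : ℝ) ^ (2 * H) + (s : ℝ) ^ (2 * H) - |(t : ℝ) - (s : ℝ)| ^ (2 * H))
  continuous_paths : ∀ᵐ ω ∂P, Continuous (fun t : ℝ≥0 => X t ω)

/-- `B` is a `d`-dimensional fractional Brownian motion with Hurst parameter `H` under `P`:
its coordinate processes are one-dimensional fractional Brownian motions with parameter `H`
and they are independent (as random elements of the path space `ℝ≥0 → ℝ`). -/
structure IsFractionalBrownian {Ω : Type*} [MeasurableSpace Ω] {d : ℕ} (H : ℝ)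
    (B : ℝ≥0 → Ω → EuclideanSpace ℝ (Fin d)) (P : Measure Ω) : Prop where
  coord : ∀ i : Fin d, IsFractionalBrownianReal H (fun t ω => B t ω i) P
  indep : iIndepFun (fun (i : Fin d) (ω : Ω) (t : ℝ≥0) => B t ω i) P

/-- The perpetual integral functional `∫₀^∞ f (x + B t) dt`, as a random variable. -/
noncomputable def perpetualIntegral {Ω : Type*} {d : ℕ} (f : EuclideanSpace ℝ (Fin d) → ℝ)
    (x : EuclideanSpace ℝ (Fin d)) (B : ℝ≥0 → Ω → EuclideanSpace ℝ (Fin d)) (ω : Ω) : ℝ :=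
  ∫ t in Ioi (0 : ℝ), f (x + B t.toNNReal ω)

/-- The constant `C_{d,H} = 2^{-(1 + 1/(2H))} H⁻¹ π^{-d/2} Γ(d/2 - 1/(2H))`. -/
noncomputable def fbmConstant (d : ℕ) (H : ℝ) : ℝ :=
  (2 : ℝ) ^ (-(1 + 1 / (2 * H))) * H⁻¹ * Real.pi ^ (-((d : ℝ) / 2)) *
    Real.Gamma ((d : ℝ) / 2 - 1 / (2 * H))

/-!
# Perpetual integral functionals of fractional Brownian motion

Write `R(t, s)` for the covariance of one coordinate and `I = ∫₀^∞ f (x + B_t) dt`.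

*Mean.* The law of `B_t` has the isotropic Gaussian density of variance `t^{2H}`, so
`E |f (x + B_t)| ≤ q(t) = min (M, N t^{-Hd})`, which is integrable on `(0, ∞)` because `Hd > 1`.
Fubini turns `E I` into an integral of `f` against `∫₀^∞ p_{t^{2H}}(z) dt`, and the substitution
`y = t^{-2H}` makes this a Gamma integral, the Riesz kernel `C ‖z‖^{1/H - d}`
(`integral_rpow_isoGaussianPDF`).

*Second moment.* For `s < t` the regression residual of `B_t` on `B_s` is independent of `B_s` and
isotropic with variance at least `κ (t - s)^{2H}` (`lndConst_mul_rpow_le`). Conditioning on the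
earlier time gives `E |f (x + B_s)| |f (x + B_t)| ≤ q(s) q(t - s)`, whose double integral is finite.

*Non-constancy.* Suppose `I = c` almost surely. Let `Z = ∑ a_s ⟪y, B_s⟫`, and let
`h = ∑ a_s R(·, s)`. Under the weight `exp (Z - Var Z / 2)`, whose mean is `1`, the law of `B_t` is
translated by `h(t) y`. Testing `I = c` against this weight gives `∫₀^∞ g(t, h(t) y) dt = c`, where
`g(t, z) = E f (x + z + B_t)`. The functions `R(·, s)` span a dense subspace of `L²(e^{-t} dt)`: by
the spectral representation of `R`, a function orthogonal to all of them has a constant Fourier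
transform, hence vanishes (`exists_fbmComb_tendsto_ae`). As `|g(t, ·)| ≤ q(t)`, dominated
convergence extends the identity to every bounded measurable `h`. Taking `h = 1` on `(0, ε]` and
`h = n` afterwards, and letting `n → ∞`, leaves `∫₀^ε g(t, y) dt = c` for every `ε` and every
`y ≠ 0`. Thus `c = 0` and, since `g(t, y) → f (x + y)` as `t → 0`, also `f = 0`.
-/

open Filter Topology
open scoped ENNReal RealInnerProductSpace

/-! ### Spectral representation of the covariance -/

/-- The covariance `R(t, s)` of fractional Brownian motion, as a function on `ℝ × ℝ`. -/
noncomputable def fbmCov (H t s : ℝ) : ℝ :=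
  (1 / 2 : ℝ) * (t ^ (2 * H) + s ^ (2 * H) - |t - s| ^ (2 * H))

lemma abs_fbmCov_le {H t s : ℝ} (hH : 0 < H) (ht : 0 ≤ t) (hs : 0 ≤ s) :
    |fbmCov H t s| ≤ t ^ (2 * H) + s ^ (2 * H) := by
  have h1 : 0 ≤ t ^ (2 * H) := Real.rpow_nonneg ht _
  have h2 : 0 ≤ s ^ (2 * H) := Real.rpow_nonneg hs _
  have h3 : 0 ≤ |t - s| ^ (2 * H) := Real.rpow_nonneg (abs_nonneg _) _
  have h4 : |t - s| ^ (2 * H) ≤ t ^ (2 * H) + s ^ (2 * H) := by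
    rcases le_total t s with h | h
    · have : |t - s| ≤ s := by rw [abs_le]; constructor <;> linarith
      have := Real.rpow_le_rpow (abs_nonneg _) this (by positivity : 0 ≤ 2 * H)
      linarith
    · have : |t - s| ≤ t := by rw [abs_le]; constructor <;> linarith
      have := Real.rpow_le_rpow (abs_nonneg _) this (by positivity : 0 ≤ 2 * H)
      linarith
  unfold fbmCov
  rw [abs_le]
  constructor <;> linarith

lemma continuous_fbmCov {H : ℝ} (hH : 0 < H) (s : ℝ) : Continuous fun t => fbmCov H t s := by
  unfold fbmCov
  have h : 0 ≤ 2 * H := by positivity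
  exact continuous_const.mul (((Real.continuous_rpow_const h).add continuous_const).sub
    ((Real.continuous_rpow_const h).comp (continuous_id.sub continuous_const).abs))

lemma integrableOn_one_sub_cos_mul_rpow {H : ℝ} (hH0 : 0 < H) (hH1 : H < 1) :
    IntegrableOn (fun ξ : ℝ => (1 - Real.cos ξ) * ξ ^ (-1 - 2 * H)) (Ioi 0) := by
  have hmeas : Measurable fun ξ : ℝ => (1 - Real.cos ξ) * ξ ^ (-1 - 2 * H) := by fun_prop
  rw [← Ioc_union_Ioi_eq_Ioi (zero_le_one (α := ℝ))]
  refine IntegrableOn.union ?_ ?_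
  · have h : IntegrableOn (fun ξ : ℝ => ξ ^ (1 - 2 * H)) (Ioc 0 1) := by
      rw [← intervalIntegrable_iff_integrableOn_Ioc_of_le zero_le_one]
      exact intervalIntegral.intervalIntegrable_rpow' (by linarith)
    refine h.mono' hmeas.aestronglyMeasurable ?_
    filter_upwards [ae_restrict_mem measurableSet_Ioc] with ξ hξ
    have hp : 0 ≤ ξ ^ (-1 - 2 * H) := Real.rpow_nonneg hξ.1.le _
    rw [Real.norm_of_nonneg (mul_nonneg (by linarith [Real.cos_le_one ξ]) hp)]
    have : ξ ^ (1 - 2 * H) = ξ ^ 2 * ξ ^ (-1 - 2 * H) := by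
      rw [← Real.rpow_natCast ξ 2, ← Real.rpow_add hξ.1]; congr 1; push_cast; ring
    rw [this]
    refine mul_le_mul_of_nonneg_right ?_ hp
    have := Real.one_sub_sq_div_two_le_cos (x := ξ)
    nlinarith [sq_nonneg ξ]
  · have h : IntegrableOn (fun ξ : ℝ => 2 * ξ ^ (-1 - 2 * H)) (Ioi 1) :=
      (integrableOn_Ioi_rpow_of_lt (by linarith) zero_lt_one).const_mul 2
    refine h.mono' hmeas.aestronglyMeasurable ?_
    filter_upwards [ae_restrict_mem measurableSet_Ioi] with ξ hξ
    have hξ' : (0 : ℝ) < ξ := zero_lt_one.trans hξ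
    have hp : 0 ≤ ξ ^ (-1 - 2 * H) := Real.rpow_nonneg hξ'.le _
    rw [Real.norm_of_nonneg (mul_nonneg (by linarith [Real.cos_le_one ξ]) hp)]
    exact mul_le_mul_of_nonneg_right (by linarith [Real.neg_one_le_cos ξ]) hp

/-- The normalisation `∫₀^∞ (1 - cos ξ) ξ^{-1-2H} dξ` of the spectral representation of
`|u|^{2H}`. -/
noncomputable def spectralConst (H : ℝ) : ℝ :=
  ∫ ξ in Ioi (0 : ℝ), (1 - Real.cos ξ) * ξ ^ (-1 - 2 * H)

/-- The rescaling `ξ ↦ |u| ξ` of `integrableOn_one_sub_cos_mul_rpow`. -/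
lemma integrableOn_one_sub_cos_mul_right {H : ℝ} (hH0 : 0 < H) (hH1 : H < 1) (u : ℝ) :
    IntegrableOn (fun ξ : ℝ => (1 - Real.cos (ξ * u)) * ξ ^ (-1 - 2 * H)) (Ioi 0) := by
  rcases eq_or_ne u 0 with rfl | hu
  · simp
  have hu' : 0 < |u| := abs_pos.2 hu
  have h := (integrableOn_Ioi_comp_mul_left_iff
    (fun ξ : ℝ => (1 - Real.cos ξ) * ξ ^ (-1 - 2 * H)) 0 hu').2
    (by simpa using integrableOn_one_sub_cos_mul_rpow hH0 hH1)
  refine IntegrableOn.congr_fun (h.const_mul (|u| ^ (1 + 2 * H))) (fun ξ hξ => ?_)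
    measurableSet_Ioi
  have hξ' : 0 ≤ ξ := le_of_lt hξ
  have hc : Real.cos (|u| * ξ) = Real.cos (ξ * u) := by
    rw [← Real.cos_abs (ξ * u), abs_mul, abs_of_nonneg hξ', mul_comm]
  have h1 : |u| ^ (1 + 2 * H) * |u| ^ (-1 - 2 * H) = 1 := by
    rw [← Real.rpow_add hu']; simp
  simp only [hc, Real.mul_rpow hu'.le hξ']
  linear_combination ((1 - Real.cos (ξ * u)) * ξ ^ (-1 - 2 * H)) * h1

/-- Up to a constant, `|u|^{2H}` is the integral of `1 - cos (ξu)` against `ξ^{-1-2H} dξ`. -/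
lemma integral_one_sub_cos_mul_right {H : ℝ} (hH0 : 0 < H) (u : ℝ) :
    ∫ ξ in Ioi (0 : ℝ), (1 - Real.cos (ξ * u)) * ξ ^ (-1 - 2 * H)
      = |u| ^ (2 * H) * spectralConst H := by
  rcases eq_or_ne u 0 with rfl | hu
  · simp [Real.zero_rpow (by positivity : 2 * H ≠ 0)]
  have hu' : 0 < |u| := abs_pos.2 hu
  have h := integral_comp_mul_left_Ioi
    (fun ξ : ℝ => (1 - Real.cos ξ) * ξ ^ (-1 - 2 * H)) 0 hu'
  rw [mul_zero, smul_eq_mul] at h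
  have h1 : |u| ^ (1 + 2 * H) * |u| ^ (-1 - 2 * H) = 1 := by
    rw [← Real.rpow_add hu']; simp
  have h2 : |u| ^ (1 + 2 * H) * |u|⁻¹ = |u| ^ (2 * H) := by
    rw [← Real.rpow_neg_one, ← Real.rpow_add hu']; congr 1; ring
  rw [spectralConst, ← h2, mul_assoc, ← h, ← integral_const_mul]
  refine setIntegral_congr_fun measurableSet_Ioi fun ξ hξ => ?_
  have hξ' : 0 ≤ ξ := le_of_lt hξ
  have hc : Real.cos (|u| * ξ) = Real.cos (ξ * u) := by
    rw [← Real.cos_abs (ξ * u), abs_mul, abs_of_nonneg hξ', mul_comm]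
  simp only [hc, Real.mul_rpow hu'.le hξ']
  linear_combination (-(1 - Real.cos (ξ * u)) * ξ ^ (-1 - 2 * H)) * h1

/-- The kernel `Re ((e^{iξt} - 1) * conj (e^{iξs} - 1))`. -/
noncomputable def spectralKernel (ξ t s : ℝ) : ℝ :=
  (1 - Real.cos (ξ * t)) * (1 - Real.cos (ξ * s)) + Real.sin (ξ * t) * Real.sin (ξ * s)

lemma spectralKernel_eq (ξ t s : ℝ) : spectralKernel ξ t s =
    (1 - Real.cos (ξ * t)) + (1 - Real.cos (ξ * s)) - (1 - Real.cos (ξ * (t - s))) := by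
  rw [mul_sub, Real.cos_sub, spectralKernel]; ring

lemma abs_spectralKernel_le (ξ t s : ℝ) : |spectralKernel ξ t s| ≤
    (1 - Real.cos (ξ * t)) + (1 - Real.cos (ξ * s)) := by
  unfold spectralKernel
  have h1 := Real.sin_sq_add_cos_sq (ξ * t)
  have h2 := Real.sin_sq_add_cos_sq (ξ * s)
  have h3 := Real.cos_le_one (ξ * t)
  have h4 := Real.cos_le_one (ξ * s)
  rw [abs_le]
  constructor
  · nlinarith [sq_nonneg (Real.sin (ξ * t) + Real.sin (ξ * s)),
      sq_nonneg ((1 - Real.cos (ξ * t)) + (1 - Real.cos (ξ * s)))]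
  · nlinarith [sq_nonneg (Real.sin (ξ * t) - Real.sin (ξ * s)),
      sq_nonneg ((1 - Real.cos (ξ * t)) - (1 - Real.cos (ξ * s)))]

/-- Spectral representation of the fractional Brownian covariance. -/
lemma integral_spectralKernel {H : ℝ} (hH0 : 0 < H) (hH1 : H < 1) {t s : ℝ}
    (ht : 0 ≤ t) (hs : 0 ≤ s) :
    ∫ ξ in Ioi (0 : ℝ), spectralKernel ξ t s * ξ ^ (-1 - 2 * H)
      = 2 * spectralConst H * fbmCov H t s := by
  have e : ∀ ξ : ℝ, spectralKernel ξ t s * ξ ^ (-1 - 2 * H) =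
      (1 - Real.cos (ξ * t)) * ξ ^ (-1 - 2 * H) + (1 - Real.cos (ξ * s)) * ξ ^ (-1 - 2 * H)
        - (1 - Real.cos (ξ * (t - s))) * ξ ^ (-1 - 2 * H) := fun ξ => by
    rw [spectralKernel_eq]; ring
  simp only [e]
  have i := integrableOn_one_sub_cos_mul_right hH0 hH1
  rw [integral_sub (by exact (i t).add (i s)) (i _), integral_add (i t) (i s),
    integral_one_sub_cos_mul_right hH0, integral_one_sub_cos_mul_right hH0,
    integral_one_sub_cos_mul_right hH0, abs_of_nonneg ht, abs_of_nonneg hs, fbmCov]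
  ring

lemma abs_one_sub_cos_le (u : ℝ) : |1 - Real.cos u| ≤ 2 := by
  rw [abs_le]
  constructor <;> linarith [Real.cos_le_one u, Real.neg_one_le_cos u]

lemma integrable_mul_one_sub_cos {φ : ℝ → ℝ} {ν : Measure ℝ} (hφ : Integrable φ ν) (ξ : ℝ) :
    Integrable (fun t => φ t * (1 - Real.cos (ξ * t))) ν := by
  refine (hφ.abs.mul_const 2).mono' (hφ.aestronglyMeasurable.mul (by fun_prop))
    (ae_of_all _ fun t => ?_)
  rw [norm_mul]
  exact mul_le_mul_of_nonneg_left (abs_one_sub_cos_le _) (abs_nonneg _)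

lemma integrable_mul_sin {φ : ℝ → ℝ} {ν : Measure ℝ} (hφ : Integrable φ ν) (ξ : ℝ) :
    Integrable (fun t => φ t * Real.sin (ξ * t)) ν := by
  refine hφ.abs.mono' (hφ.aestronglyMeasurable.mul (by fun_prop)) (ae_of_all _ fun t => ?_)
  rw [norm_mul]
  exact mul_le_of_le_one_right (abs_nonneg _) (Real.abs_sin_le_one _)

lemma continuous_integral_cos_mul {φ : ℝ → ℝ} {ν : Measure ℝ} (hφ : Integrable φ ν) :
    Continuous fun ξ : ℝ => ∫ t, φ t * (1 - Real.cos (ξ * t)) ∂ν := by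
  refine continuous_of_dominated (bound := fun t => |φ t| * 2)
    (fun ξ => (integrable_mul_one_sub_cos hφ ξ).aestronglyMeasurable)
    (fun ξ => ae_of_all _ fun t => ?_) (hφ.abs.mul_const 2) (ae_of_all _ fun t => by fun_prop)
  rw [norm_mul]
  exact mul_le_mul_of_nonneg_left (abs_one_sub_cos_le _) (abs_nonneg _)

lemma continuous_integral_sin_mul {φ : ℝ → ℝ} {ν : Measure ℝ} (hφ : Integrable φ ν) :
    Continuous fun ξ : ℝ => ∫ t, φ t * Real.sin (ξ * t) ∂ν := by
  refine continuous_of_dominated (bound := fun t => |φ t|)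
    (fun ξ => (integrable_mul_sin hφ ξ).aestronglyMeasurable)
    (fun ξ => ae_of_all _ fun t => ?_) hφ.abs (ae_of_all _ fun t => by fun_prop)
  rw [norm_mul]
  exact mul_le_of_le_one_right (abs_nonneg _) (Real.abs_sin_le_one _)

/-- If `φ` is orthogonal to `R(·, s)` for almost every `s`, then the quadratic form
`∬ φ(t) φ(s) R(t, s)` vanishes; by the spectral representation it is a positive weighted integral
of `|∫ φ(t) (e^{iξt} - 1) dt|²`, which must vanish identically. -/
lemma integral_cos_sin_eq_zero_of_orthogonal_fbmCov {H : ℝ} (hH0 : 0 < H) (hH1 : H < 1)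
    {φ : ℝ → ℝ} (hφ : IntegrableOn φ (Ioi 0))
    (hφH : IntegrableOn (fun t => φ t * t ^ (2 * H)) (Ioi 0))
    (h0 : ∀ s : ℝ, 0 ≤ s → ∫ t in Ioi (0 : ℝ), φ t * fbmCov H t s = 0) (ξ : ℝ) :
    ∫ t in Ioi (0 : ℝ), φ t * (1 - Real.cos (ξ * t)) = 0 ∧
      ∫ t in Ioi (0 : ℝ), φ t * Real.sin (ξ * t) = 0 := by
  set ν : Measure ℝ := volume.restrict (Ioi 0) with hν
  have hmemν : ∀ᵐ t ∂ν, 0 < t := ae_restrict_mem measurableSet_Ioi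
  have hmem2 : ∀ᵐ z ∂(ν.prod ν), 0 < z.1 ∧ 0 < z.2 :=
    (Measure.quasiMeasurePreserving_fst.ae hmemν).and
      (Measure.quasiMeasurePreserving_snd.ae hmemν)
  -- the integrand of the quadratic form, with the covariance expanded spectrally
  set T : (ℝ × ℝ) × ℝ → ℝ := fun w =>
    φ w.1.1 * φ w.1.2 * (spectralKernel w.2 w.1.1 w.1.2 * w.2 ^ (-1 - 2 * H)) with hT
  have hφφ : Integrable (fun z : ℝ × ℝ => φ z.1 * φ z.2) (ν.prod ν) := hφ.mul_prod hφ
  have hTm : AEStronglyMeasurable T ((ν.prod ν).prod ν) := by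
    refine hφφ.aestronglyMeasurable.comp_fst.mul ?_
    refine Measurable.aestronglyMeasurable ?_
    unfold spectralKernel
    fun_prop
  have hker : ∀ t s : ℝ, IntegrableOn (fun ξ : ℝ => spectralKernel ξ t s * ξ ^ (-1 - 2 * H))
      (Ioi 0) := fun t s => by
    have i := integrableOn_one_sub_cos_mul_right hH0 hH1
    refine (((i t).add (i s)).sub (i (t - s))).congr (ae_of_all _ fun ξ => ?_)
    simp only [Pi.add_apply, Pi.sub_apply, spectralKernel_eq]; ring
  have hTint : Integrable T ((ν.prod ν).prod ν) := by
    rw [integrable_prod_iff hTm]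
    refine ⟨ae_of_all _ fun z => (hker z.1 z.2).const_mul (φ z.1 * φ z.2), ?_⟩
    have hb : Integrable (fun z : ℝ × ℝ => spectralConst H *
        (|φ z.1 * z.1 ^ (2 * H)| * |φ z.2| + |φ z.1| * |φ z.2 * z.2 ^ (2 * H)|)) (ν.prod ν) :=
      ((hφH.abs.mul_prod hφ.abs).add (hφ.abs.mul_prod hφH.abs)).const_mul _
    refine hb.mono' hTm.norm.integral_prod_right' ?_
    filter_upwards [hmem2] with z hz
    rw [Real.norm_of_nonneg (integral_nonneg fun _ => norm_nonneg _)]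
    have i := integrableOn_one_sub_cos_mul_right hH0 hH1
    calc ∫ ξ, ‖T (z, ξ)‖ ∂ν
        ≤ ∫ ξ, |φ z.1 * φ z.2| * ((1 - Real.cos (ξ * z.1)) * ξ ^ (-1 - 2 * H)
            + (1 - Real.cos (ξ * z.2)) * ξ ^ (-1 - 2 * H)) ∂ν := by
          refine integral_mono_ae ((hker z.1 z.2).const_mul (φ z.1 * φ z.2)).norm
            (((i z.1).add (i z.2)).const_mul _) ?_
          filter_upwards [hmemν] with ξ hξ
          have hp : 0 ≤ ξ ^ (-1 - 2 * H) := Real.rpow_nonneg hξ.le _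
          simp only [hT, norm_mul, Real.norm_eq_abs, abs_mul, abs_of_nonneg hp]
          refine mul_le_mul_of_nonneg_left ?_ (by positivity)
          rw [← add_mul]
          exact mul_le_mul_of_nonneg_right (abs_spectralKernel_le _ _ _) hp
      _ = _ := by
          rw [integral_const_mul, integral_add (i z.1) (i z.2),
            integral_one_sub_cos_mul_right hH0, integral_one_sub_cos_mul_right hH0]
          simp only [abs_mul, abs_of_nonneg hz.1.le, abs_of_nonneg hz.2.le,
            abs_of_nonneg (Real.rpow_nonneg hz.1.le (2 * H)),
            abs_of_nonneg (Real.rpow_nonneg hz.2.le (2 * H))]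
          ring
  set A : ℝ → ℝ := fun ξ => ∫ t, φ t * (1 - Real.cos (ξ * t)) ∂ν with hA
  set S : ℝ → ℝ := fun ξ => ∫ t, φ t * Real.sin (ξ * t) ∂ν with hS
  have iA := integrable_mul_one_sub_cos hφ
  have iS := integrable_mul_sin hφ
  have hin : ∀ ξ, ∫ z, T (z, ξ) ∂(ν.prod ν) = (A ξ ^ 2 + S ξ ^ 2) * ξ ^ (-1 - 2 * H) := fun ξ => by
    have e : ∀ z : ℝ × ℝ, T (z, ξ) = ξ ^ (-1 - 2 * H) *
        ((φ z.1 * (1 - Real.cos (ξ * z.1))) * (φ z.2 * (1 - Real.cos (ξ * z.2))) +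
        (φ z.1 * Real.sin (ξ * z.1)) * (φ z.2 * Real.sin (ξ * z.2))) := fun z => by
      simp only [hT, spectralKernel]; ring
    simp only [e]
    rw [integral_const_mul, integral_add ((iA ξ).mul_prod (iA ξ)) ((iS ξ).mul_prod (iS ξ)),
      integral_prod_mul (fun t => φ t * (1 - Real.cos (ξ * t)))
        (fun t => φ t * (1 - Real.cos (ξ * t))),
      integral_prod_mul (fun t => φ t * Real.sin (ξ * t)) (fun t => φ t * Real.sin (ξ * t))]
    ring
  have hzero : ∫ z, ∫ ξ, T (z, ξ) ∂ν ∂(ν.prod ν) = 0 := by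
    have e : ∀ᵐ z ∂(ν.prod ν), ∫ ξ, T (z, ξ) ∂ν =
        2 * spectralConst H * (φ z.1 * φ z.2 * fbmCov H z.1 z.2) := by
      filter_upwards [hmem2] with z hz
      simp only [hT]
      rw [integral_const_mul, integral_spectralKernel hH0 hH1 hz.1.le hz.2.le]
      ring
    have hi := hTint.integral_prod_left
    rw [integral_prod_symm _ hi]
    refine integral_eq_zero_of_ae ?_
    have e' : ∀ᵐ w ∂(ν.prod ν), ∫ ξ, T (w.swap, ξ) ∂ν =
        2 * spectralConst H * (φ w.2 * φ w.1 * fbmCov H w.2 w.1) :=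
      Measure.measurePreserving_swap.quasiMeasurePreserving.ae e
    filter_upwards [Measure.ae_ae_of_ae_prod e', hmemν] with s hs hs0
    have : ∀ᵐ t ∂ν, ∫ ξ, T ((t, s), ξ) ∂ν =
        2 * spectralConst H * φ s * (φ t * fbmCov H t s) := by
      filter_upwards [hs] with t ht
      rw [Prod.swap_prod_mk] at ht
      simp only [ht]; ring
    rw [integral_congr_ae this, integral_const_mul, h0 s hs0.le]
    simp
  rw [integral_integral_swap (f := fun z ξ => T (z, ξ)) hTint] at hzero
  simp only [hin] at hzero
  have hint2 : Integrable (fun ξ => (A ξ ^ 2 + S ξ ^ 2) * ξ ^ (-1 - 2 * H)) ν := by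
    have := hTint.integral_prod_right
    simpa only [hin] using this
  have hae : ∀ᵐ ξ ∂ν, A ξ ^ 2 + S ξ ^ 2 = 0 := by
    have h := (integral_eq_zero_iff_of_nonneg_ae ?_ hint2).1 hzero
    · filter_upwards [h, hmemν] with ξ hξ hξ0
      simpa [(Real.rpow_pos_of_pos hξ0 (-1 - 2 * H)).ne'] using hξ
    · filter_upwards [hmemν] with ξ hξ0
      exact mul_nonneg (by positivity) (Real.rpow_nonneg hξ0.le _)
  have hAc : Continuous A := continuous_integral_cos_mul hφ
  have hSc : Continuous S := continuous_integral_sin_mul hφ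
  have hpos : EqOn (fun ξ => A ξ ^ 2 + S ξ ^ 2) (fun _ => 0) (Ioi 0) :=
    Measure.eqOn_open_of_ae_eq hae isOpen_Ioi
      ((hAc.pow 2).add (hSc.pow 2)).continuousOn continuousOn_const
  have key : ∀ ξ, 0 < ξ → A ξ = 0 ∧ S ξ = 0 := fun ξ hξ => by
    have := hpos hξ
    simp only at this
    constructor <;> nlinarith [sq_nonneg (A ξ), sq_nonneg (S ξ)]
  rcases lt_trichotomy ξ 0 with h | rfl | h
  · have := key (-ξ) (by linarith)
    simpa [hA, hS, neg_mul, Real.cos_neg, Real.sin_neg, integral_neg] using this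
  · simp
  · exact key ξ h

/-! ### Density of the span of the covariance functions -/

/-- A function on `(0, ∞)` whose Fourier transform is constant vanishes: the signed measure
`φ(t) dt - (∫ φ) δ₀` has zero characteristic function, and `δ₀` does not charge `(0, ∞)`. -/
lemma ae_eq_zero_of_integral_cos_sin_eq_zero {φ : ℝ → ℝ} (hφ : IntegrableOn φ (Ioi 0))
    (h : ∀ ξ : ℝ, ∫ t in Ioi (0 : ℝ), φ t * (1 - Real.cos (ξ * t)) = 0 ∧
      ∫ t in Ioi (0 : ℝ), φ t * Real.sin (ξ * t) = 0) :
    φ =ᵐ[volume.restrict (Ioi 0)] 0 := by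
  set ν : Measure ℝ := volume.restrict (Ioi 0) with hν
  -- finite measures with density `g`, plus an atom at the origin
  let m : (ℝ → ℝ) → ℝ → Measure ℝ := fun g c =>
    ν.withDensity (fun t => ENNReal.ofReal (g t)) + ENNReal.ofReal c • Measure.dirac 0
  have hchar : ∀ (g : ℝ → ℝ) (c : ℝ), Integrable g ν → (∀ t, 0 ≤ g t) → 0 ≤ c → ∀ ξ : ℝ,
      charFun (m g c) ξ = ∫ t, (g t : ℂ) * Complex.exp (ξ * t * Complex.I) ∂ν + c := by
    intro g c hg hg0 hc ξ
    have hE : Continuous fun t : ℝ => Complex.exp (ξ * t * Complex.I) := by fun_prop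
    have hn : ∀ t : ℝ, ‖Complex.exp (ξ * t * Complex.I)‖ = 1 := fun t => by
      rw [← Complex.ofReal_mul]; exact Complex.norm_exp_ofReal_mul_I _
    have : IsFiniteMeasure (ν.withDensity (fun t => ENNReal.ofReal (g t))) :=
      isFiniteMeasure_withDensity_ofReal hg.2
    have : IsFiniteMeasure (ENNReal.ofReal c • Measure.dirac (0 : ℝ)) :=
      Measure.smul_finite _ ENNReal.ofReal_ne_top
    have hi : ∀ μ : Measure ℝ, IsFiniteMeasure μ →
        Integrable (fun t : ℝ => Complex.exp (ξ * t * Complex.I)) μ := fun μ _ =>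
      (integrable_const (1 : ℝ)).mono' hE.aestronglyMeasurable
        (ae_of_all _ fun t => (hn t).le)
    rw [charFun_apply_real, integral_add_measure (hi _ ‹_›) (hi _ ‹_›),
      integral_withDensity_eq_integral_toReal_smul₀ hg.aemeasurable.ennreal_ofReal
        (ae_of_all _ fun _ => ENNReal.ofReal_lt_top)]
    congr 1
    · refine integral_congr_ae (ae_of_all _ fun t => ?_)
      simp [ENNReal.toReal_ofReal (hg0 t)]
    · simp [integral_smul_measure, ENNReal.toReal_ofReal hc]
  have hpos : Integrable (fun t => max (φ t) 0) ν := hφ.pos_part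
  have hneg : Integrable (fun t => max (-φ t) 0) ν := hφ.neg_part
  set a := ∫ t, max (φ t) 0 ∂ν with ha
  set b := ∫ t, max (-φ t) 0 ∂ν with hb
  have ha0 : 0 ≤ a := integral_nonneg fun _ => le_max_right _ _
  have hb0 : 0 ≤ b := integral_nonneg fun _ => le_max_right _ _
  have hsplit : ∀ t, φ t = max (φ t) 0 - max (-φ t) 0 := fun t => by
    rcases le_total (φ t) 0 with h | h <;> simp [h]
  have hfin : ∀ (g : ℝ → ℝ) (c : ℝ), Integrable g ν → IsFiniteMeasure (m g c) := by
    intro g c hg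
    have : IsFiniteMeasure (ν.withDensity (fun t => ENNReal.ofReal (g t))) :=
      isFiniteMeasure_withDensity_ofReal hg.2
    have : IsFiniteMeasure (ENNReal.ofReal c • Measure.dirac (0 : ℝ)) :=
      Measure.smul_finite _ ENNReal.ofReal_ne_top
    infer_instance
  have hexpint : ∀ (g : ℝ → ℝ) (ξ : ℝ), Integrable g ν →
      Integrable (fun t => (g t : ℂ) * Complex.exp (ξ * t * Complex.I)) ν := by
    intro g ξ hg
    refine hg.abs.mono' ((Complex.continuous_ofReal.comp_aestronglyMeasurable
      hg.aestronglyMeasurable).mul (by fun_prop)) (ae_of_all _ fun t => ?_)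
    rw [norm_mul, ← Complex.ofReal_mul, Complex.norm_exp_ofReal_mul_I, mul_one,
      Complex.norm_real, Real.norm_eq_abs]
  have hm : m (fun t => max (φ t) 0) b = m (fun t => max (-φ t) 0) a := by
    have := hfin _ b hpos
    have := hfin _ a hneg
    refine Measure.ext_of_charFun (funext fun ξ => ?_)
    rw [hchar _ _ hpos (fun _ => le_max_right _ _) hb0,
      hchar _ _ hneg (fun _ => le_max_right _ _) ha0, ← sub_eq_zero]
    have e1 : ∫ t, (φ t : ℂ) * Complex.exp (ξ * t * Complex.I) ∂ν = (∫ t, φ t ∂ν : ℝ) := by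
      have hc : Integrable (fun t => φ t * Real.cos (ξ * t)) ν := by
        refine (hφ.sub (integrable_mul_one_sub_cos hφ ξ)).congr (ae_of_all _ fun t => ?_)
        simp only [Pi.sub_apply]; ring
      have hs : Integrable (fun t => φ t * Real.sin (ξ * t)) ν := integrable_mul_sin hφ ξ
      have e : ∀ t : ℝ, (φ t : ℂ) * Complex.exp (ξ * t * Complex.I) =
          ((φ t * Real.cos (ξ * t) : ℝ) : ℂ) + ((φ t * Real.sin (ξ * t) : ℝ) : ℂ) * Complex.I := by
        intro t
        rw [Complex.exp_mul_I]; push_cast; ring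
      simp only [e]
      rw [integral_add hc.ofReal (hs.ofReal.mul_const _), integral_mul_const,
        integral_complex_ofReal, integral_complex_ofReal, (h ξ).2]
      have hcos : ∫ t, φ t * Real.cos (ξ * t) ∂ν = ∫ t, φ t ∂ν := by
        have := (h ξ).1
        simp only [mul_sub, mul_one] at this
        rw [integral_sub hφ hc] at this
        linarith
      simp [hcos]
    have e2 : ∫ t, φ t ∂ν = a - b := by
      rw [ha, hb, ← integral_sub hpos hneg]
      exact integral_congr_ae (ae_of_all _ hsplit)
    have e3 : ∫ t, (φ t : ℂ) * Complex.exp (ξ * t * Complex.I) ∂ν =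
        ∫ t, ((max (φ t) 0 : ℝ) : ℂ) * Complex.exp (ξ * t * Complex.I) ∂ν -
        ∫ t, ((max (-φ t) 0 : ℝ) : ℂ) * Complex.exp (ξ * t * Complex.I) ∂ν := by
      rw [← integral_sub (hexpint _ ξ hpos) (hexpint _ ξ hneg)]
      refine integral_congr_ae (ae_of_all _ fun t => ?_)
      simp only
      conv_lhs => rw [hsplit t]
      push_cast; ring
    rw [e1, e2] at e3
    push_cast at e3
    linear_combination -e3
  -- restricting to `(0, ∞)` removes the atoms
  have hr := congrArg (fun μ : Measure ℝ => μ.restrict (Ioi 0)) hm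
  have hd : (Measure.dirac (0 : ℝ)).restrict (Ioi 0) = 0 := by
    rw [Measure.restrict_eq_zero]; simp
  simp only [m, Measure.restrict_add, Measure.restrict_smul, hd, smul_zero, add_zero, hν,
    restrict_withDensity measurableSet_Ioi, Measure.restrict_restrict measurableSet_Ioi,
    inter_self] at hr
  have := (withDensity_eq_iff hpos.aemeasurable.ennreal_ofReal
    hneg.aemeasurable.ennreal_ofReal hpos.lintegral_lt_top.ne).1 hr
  filter_upwards [this] with t ht
  rw [ENNReal.ofReal_eq_ofReal_iff (le_max_right _ _) (le_max_right _ _)] at ht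
  rw [Pi.zero_apply, hsplit t, ht, sub_self]

/-- A finite linear combination of the functions `R(·, s)`, i.e. an element of the (algebraic)
reproducing kernel space of fractional Brownian motion. -/
noncomputable def fbmComb (H : ℝ) (a : ℝ≥0 →₀ ℝ) (t : ℝ) : ℝ :=
  a.sum fun s c => c * fbmCov H t s

lemma memLp_exp_mul_rpow {p : ℝ} (hp : 0 ≤ p) :
    MemLp (fun t : ℝ => Real.exp (-t / 2) * t ^ p) 2 (volume.restrict (Ioi 0)) := by
  rw [memLp_two_iff_integrable_sq (by fun_prop)]
  have h := Real.GammaIntegral_convergent (s := 2 * p + 1) (by linarith)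
  refine IntegrableOn.congr_fun h (fun t ht => ?_) measurableSet_Ioi
  have ht : (0 : ℝ) < t := ht
  rw [mul_pow, ← Real.exp_nat_mul, ← Real.rpow_natCast (t ^ p), ← Real.rpow_mul ht.le]
  congr 2
  · push_cast; ring
  · push_cast; ring

/-- The span of the functions `R(·, s)`, `s ≥ 0`, is dense in `L²(e^{-t} dt)` on `(0, ∞)`; along a
subsequence the approximation holds almost everywhere. -/
lemma exists_fbmComb_tendsto_ae {H : ℝ} (hH0 : 0 < H) (hH1 : H < 1) {ψ : ℝ → ℝ}
    (hψ : MemLp (fun t : ℝ => Real.exp (-t / 2) * ψ t) 2 (volume.restrict (Ioi 0))) :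
    ∃ a : ℕ → ℝ≥0 →₀ ℝ, ∀ᵐ t ∂(volume.restrict (Ioi (0 : ℝ))),
      Tendsto (fun n => fbmComb H (a n) t) atTop (𝓝 (ψ t)) := by
  set ν : Measure ℝ := volume.restrict (Ioi 0) with hν
  have hmemν : ∀ᵐ t ∂ν, 0 < t := ae_restrict_mem measurableSet_Ioi
  have h1 : MemLp (fun t : ℝ => Real.exp (-t / 2)) 2 ν := by
    simpa using memLp_exp_mul_rpow le_rfl
  have h2 : MemLp (fun t : ℝ => Real.exp (-t / 2) * t ^ (2 * H)) 2 ν :=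
    memLp_exp_mul_rpow (by positivity)
  have hr : ∀ s : ℝ≥0, MemLp (fun t : ℝ => Real.exp (-t / 2) * fbmCov H t s) 2 ν := by
    intro s
    refine (h2.add (h1.mul_const ((s : ℝ) ^ (2 * H)))).mono
      (by have := continuous_fbmCov hH0 (s : ℝ); fun_prop) ?_
    filter_upwards [hmemν] with t ht
    simp only [Pi.add_apply]
    rw [← mul_add, norm_mul, norm_mul]
    refine mul_le_mul_of_nonneg_left ?_ (norm_nonneg _)
    exact (abs_fbmCov_le hH0 ht.le s.2).trans (le_abs_self _)
  let r : ℝ≥0 → Lp ℝ 2 ν := fun s => (hr s).toLp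
  let K : Submodule ℝ (Lp ℝ 2 ν) := Submodule.span ℝ (range r)
  -- the weight `e^{-t/2}` is put into the functions, so that the Hilbert space is plain `L²(0, ∞)`
  have hK : K.topologicalClosure = ⊤ := by
    rw [Submodule.topologicalClosure_eq_top_iff, Submodule.eq_bot_iff]
    intro g hg
    have hgm : MemLp g 2 ν := Lp.memLp g
    have hint : ∀ w : ℝ → ℝ, MemLp (fun t => Real.exp (-t / 2) * w t) 2 ν →
        Integrable (fun t => Real.exp (-t / 2) * g t * w t) ν := fun w hw => by
      refine (hw.integrable_mul hgm).congr (ae_of_all _ fun t => ?_)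
      simp only [Pi.mul_apply]; ring
    have horth : ∀ s : ℝ, 0 ≤ s → ∫ t, Real.exp (-t / 2) * g t * fbmCov H t s ∂ν = 0 := by
      intro s hs
      lift s to ℝ≥0 using hs
      have := (Submodule.mem_orthogonal K g).1 hg (r s)
        (Submodule.subset_span (mem_range_self _))
      rw [L2.inner_def] at this
      rw [← this]
      refine integral_congr_ae ?_
      filter_upwards [(hr s).coeFn_toLp] with t ht
      simp only [r, ht, RCLike.inner_apply, conj_trivial]
      ring
    have hz := ae_eq_zero_of_integral_cos_sin_eq_zero
      (φ := fun t => Real.exp (-t / 2) * g t)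
      (by simpa using! hint (fun _ => 1) (by simpa using h1))
      (integral_cos_sin_eq_zero_of_orthogonal_fbmCov hH0 hH1
        (by simpa using! hint (fun _ => 1) (by simpa using h1)) (hint _ h2) horth)
    rw [Lp.eq_zero_iff_ae_eq_zero]
    filter_upwards [hz] with t ht
    simpa [Real.exp_ne_zero] using ht
  have hmem : hψ.toLp ∈ closure (K : Set (Lp ℝ 2 ν)) := by
    rw [← Submodule.topologicalClosure_coe, hK]; trivial
  obtain ⟨u, huK, hu⟩ := mem_closure_iff_seq_limit.1 hmem
  have hua : ∀ n, ∃ a : ℝ≥0 →₀ ℝ, (a.sum fun s c => c • r s) = u n := fun n =>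
    Finsupp.mem_span_range_iff_exists_finsupp.1 (huK n)
  choose a ha using hua
  obtain ⟨ns, -, hns⟩ := (tendstoInMeasure_of_tendsto_Lp hu).exists_seq_tendsto_ae
  refine ⟨fun n => a (ns n), ?_⟩
  have hcoe : ∀ n, ∀ᵐ t ∂ν, u n t = Real.exp (-t / 2) * fbmComb H (a n) t := by
    intro n
    rw [← ha n, Finsupp.sum]
    have e1 := Lp.coeFn_finsetSum (a n).support (fun s => (a n) s • r s)
    have e2 : ∀ᵐ t ∂ν, ∀ s ∈ (a n).support, ((a n) s • r s : Lp ℝ 2 ν) t =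
        (a n) s * (Real.exp (-t / 2) * fbmCov H t s) := by
      rw [Finset.eventually_all]
      intro s _
      filter_upwards [Lp.coeFn_smul ((a n) s) (r s), (hr s).coeFn_toLp] with t h1 h2
      rw [h1, Pi.smul_apply, smul_eq_mul, h2]
    filter_upwards [e1, e2] with t h1 h2
    rw [h1, Finset.sum_apply, Finset.sum_congr rfl h2, fbmComb, Finsupp.sum, Finset.mul_sum]
    refine Finset.sum_congr rfl fun s _ => by ring
  filter_upwards [hns, ae_all_iff.2 hcoe, hψ.coeFn_toLp] with t h1 h2 h3
  have := h1.const_mul (Real.exp (-t / 2))⁻¹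
  rw [h3, inv_mul_cancel_left₀ (Real.exp_ne_zero _)] at this
  refine this.congr fun n => ?_
  rw [h2, inv_mul_cancel_left₀ (Real.exp_ne_zero _)]

/-! ### Isotropic Gaussian densities, the occupation density, local nondeterminism -/

/-- The density `(2πv)^{-d/2} exp (-‖z‖² / (2v))` of the isotropic Gaussian law of variance `v`. -/
noncomputable def isoGaussianPDF {d : ℕ} (v : ℝ) (z : EuclideanSpace ℝ (Fin d)) : ℝ :=
  (2 * Real.pi * v) ^ (-((d : ℝ) / 2)) * Real.exp (-(1 / (2 * v)) * ‖z‖ ^ 2)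

lemma isoGaussianPDF_nonneg {d : ℕ} {v : ℝ} (hv : 0 ≤ v) (z : EuclideanSpace ℝ (Fin d)) :
    0 ≤ isoGaussianPDF v z := by
  unfold isoGaussianPDF; positivity

lemma isoGaussianPDF_le {d : ℕ} {v : ℝ} (hv : 0 ≤ v) (z : EuclideanSpace ℝ (Fin d)) :
    isoGaussianPDF v z ≤ (2 * Real.pi * v) ^ (-((d : ℝ) / 2)) := by
  unfold isoGaussianPDF
  refine mul_le_of_le_one_right (by positivity) (Real.exp_le_one_iff.2 ?_)
  rw [neg_mul]
  exact neg_nonpos.2 (by positivity)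

lemma measurable_isoGaussianPDF {d : ℕ} :
    Measurable fun p : ℝ × EuclideanSpace ℝ (Fin d) => isoGaussianPDF p.1 p.2 := by
  unfold isoGaussianPDF; fun_prop

lemma continuous_isoGaussianPDF {d : ℕ} (v : ℝ) :
    Continuous fun z : EuclideanSpace ℝ (Fin d) => isoGaussianPDF v z := by
  unfold isoGaussianPDF; fun_prop

lemma integrable_isoGaussianPDF {d : ℕ} {v : ℝ} (hv : 0 < v) :
    Integrable fun z : EuclideanSpace ℝ (Fin d) => isoGaussianPDF v z := by
  have h := (GaussianFourier.integrable_cexp_neg_mul_sq_norm_add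
    (V := EuclideanSpace ℝ (Fin d)) (b := ((1 / (2 * v) : ℝ) : ℂ))
    (by rw [Complex.ofReal_re]; positivity) 0 0).re
  unfold isoGaussianPDF
  refine Integrable.const_mul (h.congr (ae_of_all _ fun z => ?_)) _
  have : Complex.exp (-((1 / (2 * v) : ℝ) : ℂ) * ‖z‖ ^ 2 + 0 * ((inner ℝ 0 z : ℝ) : ℂ))
      = ((Real.exp (-(1 / (2 * v)) * ‖z‖ ^ 2) : ℝ) : ℂ) := by push_cast; simp
  exact (congrArg Complex.re this).trans (Complex.ofReal_re _)

lemma charFun_withDensity_isoGaussianPDF {d : ℕ} {v : ℝ} (hv : 0 < v)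
    (u : EuclideanSpace ℝ (Fin d)) :
    charFun (volume.withDensity fun z : EuclideanSpace ℝ (Fin d) =>
      ENNReal.ofReal (isoGaussianPDF v z)) u = Complex.exp (-(v * ‖u‖ ^ 2 / 2)) := by
  rw [charFun_apply, integral_withDensity_eq_integral_toReal_smul₀
    (continuous_isoGaussianPDF v).measurable.ennreal_ofReal.aemeasurable
    (ae_of_all _ fun _ => ENNReal.ofReal_lt_top)]
  have hvc : (v : ℂ) ≠ 0 := by exact_mod_cast hv.ne'
  have hG := GaussianFourier.integral_cexp_neg_mul_sq_norm_add
    (V := EuclideanSpace ℝ (Fin d)) (b := ((1 / (2 * v) : ℝ) : ℂ))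
    (by rw [Complex.ofReal_re]; positivity) Complex.I u
  have e : ∀ z : EuclideanSpace ℝ (Fin d),
      (ENNReal.ofReal (isoGaussianPDF v z)).toReal •
        Complex.exp (((inner ℝ z u : ℝ) : ℂ) * Complex.I)
      = (((2 * Real.pi * v) ^ (-((d : ℝ) / 2)) : ℝ) : ℂ) *
        Complex.exp (-((1 / (2 * v) : ℝ) : ℂ) * ‖z‖ ^ 2 + Complex.I * ((inner ℝ u z : ℝ) : ℂ)) := by
    intro z
    rw [ENNReal.toReal_ofReal (isoGaussianPDF_nonneg hv.le z), isoGaussianPDF, Complex.exp_add,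
      real_inner_comm, Complex.real_smul]
    push_cast
    ring_nf
  simp only [e]
  rw [integral_const_mul, hG, finrank_euclideanSpace_fin]
  have h1 : (Real.pi : ℂ) / ((1 / (2 * v) : ℝ) : ℂ) = ((2 * Real.pi * v : ℝ) : ℂ) := by
    push_cast; field_simp
  have hp : 0 < 2 * Real.pi * v := by positivity
  have h2 : ((2 * Real.pi * v : ℝ) : ℂ) ^ ((d : ℂ) / 2)
      = (((2 * Real.pi * v) ^ ((d : ℝ) / 2) : ℝ) : ℂ) := by
    rw [Complex.ofReal_cpow hp.le]; push_cast; rfl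
  rw [h1, h2, ← mul_assoc, ← Complex.ofReal_mul, ← Real.rpow_add hp, neg_add_cancel,
    Real.rpow_zero, Complex.ofReal_one, one_mul]
  congr 1
  rw [Complex.I_sq]
  push_cast
  field_simp
  ring

lemma eq_withDensity_isoGaussianPDF {d : ℕ} {v : ℝ} (hv : 0 < v)
    {μ : Measure (EuclideanSpace ℝ (Fin d))} [IsFiniteMeasure μ]
    (h : ∀ u, charFun μ u = Complex.exp (-(v * ‖u‖ ^ 2 / 2))) :
    μ = volume.withDensity fun z => ENNReal.ofReal (isoGaussianPDF v z) := by
  have : IsFiniteMeasure (volume.withDensity fun z : EuclideanSpace ℝ (Fin d) =>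
      ENNReal.ofReal (isoGaussianPDF v z)) :=
    isFiniteMeasure_withDensity_ofReal (integrable_isoGaussianPDF hv).2
  refine Measure.ext_of_charFun (funext fun u => ?_)
  rw [h, charFun_withDensity_isoGaussianPDF hv]

/-- The exponent `α = d/2 - 1/(2H)` of the radial integral is positive since `1/H < d`. -/
lemma half_sub_pos {d : ℕ} {H : ℝ} (hH0 : 0 < H) (hd : 1 / H < (d : ℝ)) :
    0 < (d : ℝ) / 2 - 1 / (2 * H) := by
  have : 1 / (2 * H) = (1 / H) / 2 := by field_simp
  rw [this]; linarith

/-- The Gaussian density at time `t`, written for the substitution `y = t^{-2H}`. -/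
lemma rpow_isoGaussianPDF_eq {d : ℕ} {H : ℝ} (hH0 : 0 < H)
    (z : EuclideanSpace ℝ (Fin d)) {t : ℝ} (ht : 0 < t) :
    isoGaussianPDF (t ^ (2 * H)) z = ((2 * Real.pi) ^ (-((d : ℝ) / 2)) * (2 * H)⁻¹) *
      ((|-(2 * H)| * t ^ (-(2 * H) - 1)) •
        ((t ^ (-(2 * H))) ^ ((d : ℝ) / 2 - 1 / (2 * H) - 1) *
          Real.exp (-(‖z‖ ^ 2 / 2 * t ^ (-(2 * H)))))) := by
  have h1 : t ^ (-(2 * H) - 1) * (t ^ (-(2 * H))) ^ ((d : ℝ) / 2 - 1 / (2 * H) - 1)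
      = (t ^ (2 * H)) ^ (-((d : ℝ) / 2)) := by
    rw [← Real.rpow_mul ht.le, ← Real.rpow_mul ht.le, ← Real.rpow_add ht]
    congr 1; field_simp; ring
  have h2 : -(1 / (2 * t ^ (2 * H))) * ‖z‖ ^ 2 = -(‖z‖ ^ 2 / 2 * t ^ (-(2 * H))) := by
    rw [Real.rpow_neg ht.le]; field_simp
  rw [isoGaussianPDF, h2, Real.mul_rpow (by positivity) (by positivity), ← h1, abs_neg,
    abs_of_pos (by positivity : 0 < 2 * H), smul_eq_mul]
  field_simp

/-- The occupation density: substituting `y = t^{-2H}` turns the time integral of the Gaussian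
density into a Gamma integral. -/
lemma integral_rpow_isoGaussianPDF {d : ℕ} {H : ℝ} (hH0 : 0 < H) (hd : 1 / H < (d : ℝ))
    {z : EuclideanSpace ℝ (Fin d)} (hz : z ≠ 0) :
    ∫ t in Ioi (0 : ℝ), isoGaussianPDF (t ^ (2 * H)) z =
      fbmConstant d H / ‖z‖ ^ ((d : ℝ) - 1 / H) := by
  have hα := half_sub_pos hH0 hd
  have hz' : 0 < ‖z‖ := norm_pos_iff.2 hz
  have hb : 0 < ‖z‖ ^ 2 / 2 := by positivity
  rw [setIntegral_congr_fun measurableSet_Ioi (fun t ht => rpow_isoGaussianPDF_eq hH0 z ht),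
    integral_const_mul,
    integral_comp_rpow_Ioi (fun y => y ^ ((d : ℝ) / 2 - 1 / (2 * H) - 1) *
      Real.exp (-(‖z‖ ^ 2 / 2 * y))) (by linarith : -(2 * H) ≠ 0),
    Real.integral_rpow_mul_exp_neg_mul_Ioi hα hb, fbmConstant]
  have e1 : (1 / (‖z‖ ^ 2 / 2)) ^ ((d : ℝ) / 2 - 1 / (2 * H)) =
      2 ^ ((d : ℝ) / 2 - 1 / (2 * H)) / ‖z‖ ^ ((d : ℝ) - 1 / H) := by
    rw [one_div_div, Real.div_rpow (by norm_num) (by positivity), ← Real.rpow_natCast ‖z‖,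
      ← Real.rpow_mul hz'.le]
    congr 2; push_cast; field_simp
  have e2 : (2 : ℝ) ^ (-(1 + 1 / (2 * H))) =
      2 ^ (-((d : ℝ) / 2)) * 2⁻¹ * 2 ^ ((d : ℝ) / 2 - 1 / (2 * H)) := by
    rw [← Real.rpow_neg_one, ← Real.rpow_add two_pos, ← Real.rpow_add two_pos]
    congr 1; ring
  rw [e1, e2, Real.mul_rpow two_pos.le Real.pi_pos.le]
  field_simp

lemma one_lt_mul_of_inv_lt {d : ℕ} {H : ℝ} (hH0 : 0 < H) (hd : 1 / H < (d : ℝ)) :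
    1 < H * d := by
  rwa [div_lt_iff₀ hH0, mul_comm] at hd

/-- The bound `min (M, N u^{-Hd})` for `E |f(x + B_u)|`; it is integrable because `Hd > 1`. -/
noncomputable def occBound (d : ℕ) (H M N u : ℝ) : ℝ := min M (N * u ^ (-(H * d)))

lemma occBound_nonneg {d : ℕ} {H M N u : ℝ} (hM : 0 ≤ M) (hN : 0 ≤ N) (hu : 0 ≤ u) :
    0 ≤ occBound d H M N u :=
  le_min hM (mul_nonneg hN (Real.rpow_nonneg hu _))

lemma measurable_occBound {d : ℕ} {H M N : ℝ} : Measurable (occBound d H M N) := by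
  unfold occBound; fun_prop

lemma integrableOn_occBound {d : ℕ} {H M N : ℝ} (hH0 : 0 < H) (hd : 1 / H < (d : ℝ))
    (hM : 0 ≤ M) (hN : 0 ≤ N) : IntegrableOn (occBound d H M N) (Ioi 0) := by
  have hd' := one_lt_mul_of_inv_lt hH0 hd
  rw [← Ioc_union_Ioi_eq_Ioi (zero_le_one (α := ℝ))]
  refine IntegrableOn.union ?_ ?_
  · have : IntegrableOn (fun _ : ℝ => M) (Ioc (0 : ℝ) 1) := by simp
    refine this.mono' measurable_occBound.aestronglyMeasurable ?_
    filter_upwards [ae_restrict_mem measurableSet_Ioc] with u hu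
    rw [Real.norm_of_nonneg (occBound_nonneg hM hN hu.1.le)]
    exact min_le_left _ _
  · have : IntegrableOn (fun u : ℝ => N * u ^ (-(H * d))) (Ioi 1) :=
      (integrableOn_Ioi_rpow_of_lt (by linarith) zero_lt_one).const_mul N
    refine this.mono' measurable_occBound.aestronglyMeasurable ?_
    filter_upwards [ae_restrict_mem measurableSet_Ioi] with u hu
    have : (0 : ℝ) < u := zero_lt_one.trans hu
    rw [Real.norm_of_nonneg (occBound_nonneg hM hN this.le)]
    exact min_le_right _ _

/-- A quantitative form of the strict subadditivity of `r ↦ r^H`: if the smaller of `s`, `1 - s` is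
`r ≤ 1/2`, then `1 - (1 - r)^H ≤ r ≤ 2^{H-1} r^H`. -/
lemma rpow_add_rpow_one_sub_sub_one_ge {H : ℝ} (hH0 : 0 < H) (hH1 : H < 1) {s : ℝ}
    (hs0 : 0 < s) (hs1 : s < 1) :
    (1 - 2 ^ (H - 1)) * (s ^ H * (1 - s) ^ H) ≤ s ^ H + (1 - s) ^ H - 1 := by
  have key : ∀ r : ℝ, 0 < r → r ≤ 1 / 2 →
      (1 - 2 ^ (H - 1)) * (r ^ H * (1 - r) ^ H) ≤ r ^ H + (1 - r) ^ H - 1 := by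
    intro r hr0 hr
    have h0 : 0 ≤ 1 - r := by linarith
    have hk : (2 : ℝ) ^ (H - 1) ≤ 1 :=
      Real.rpow_le_one_of_one_le_of_nonpos (by norm_num) (by linarith)
    have h1 : 1 - r ≤ (1 - r) ^ H := by
      have := Real.rpow_le_rpow_of_exponent_ge (by linarith : 0 < 1 - r) (by linarith) hH1.le
      simpa using this
    have h2 : (1 - r) ^ H ≤ 1 := Real.rpow_le_one h0 (by linarith) hH0.le
    have h3 : r ≤ r ^ H * 2 ^ (H - 1) := by
      have h4 : r ^ (1 - H) ≤ (1 / 2) ^ (1 - H) := Real.rpow_le_rpow hr0.le hr (by linarith)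
      have h5 : ((1 : ℝ) / 2) ^ (1 - H) = 2 ^ (H - 1) := by
        rw [one_div, Real.inv_rpow two_pos.le, ← Real.rpow_neg two_pos.le]; congr 1; ring
      calc r = r ^ H * r ^ (1 - H) := by rw [← Real.rpow_add hr0]; simp
        _ ≤ _ := mul_le_mul_of_nonneg_left (h4.trans h5.le) (by positivity)
    have h6 : 0 ≤ r ^ H := by positivity
    have h7 : (1 - 2 ^ (H - 1)) * (r ^ H * (1 - r) ^ H) ≤ (1 - 2 ^ (H - 1)) * (r ^ H * 1) := by
      gcongr
    linarith
  rcases le_total s (1 / 2) with h | h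
  · exact key s hs0 h
  · have := key (1 - s) (by linarith) (by linarith)
    rw [sub_sub_cancel] at this
    linarith [mul_comm (s ^ H) ((1 - s) ^ H)]

/-- The homogeneous form of `rpow_add_rpow_one_sub_sub_one_ge`. -/
lemma rpow_add_rpow_sub_sub_rpow_ge {H : ℝ} (hH0 : 0 < H) (hH1 : H < 1) {s t : ℝ}
    (hs : 0 < s) (hst : s < t) :
    (1 - 2 ^ (H - 1)) * (s ^ H * (t - s) ^ H) ≤ t ^ H * (s ^ H + (t - s) ^ H - t ^ H) := by
  have ht : 0 < t := hs.trans hst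
  have h := rpow_add_rpow_one_sub_sub_one_ge hH0 hH1 (div_pos hs ht) ((div_lt_one ht).2 hst)
  have h1 : 1 - s / t = (t - s) / t := by field_simp
  rw [h1, Real.div_rpow hs.le ht.le, Real.div_rpow (by linarith) ht.le] at h
  have hT : 0 < t ^ H := by positivity
  have := mul_le_mul_of_nonneg_left h (by positivity : 0 ≤ t ^ H * t ^ H)
  calc _ = t ^ H * t ^ H * ((1 - 2 ^ (H - 1)) * (s ^ H / t ^ H * ((t - s) ^ H / t ^ H))) := by
        field_simp
    _ ≤ _ := this
    _ = _ := by field_simp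

/-- The constant `κ` in the local nondeterminism bound `Var (B_t | B_s) ≥ κ (t - s)^{2H}`. -/
noncomputable def lndConst (H : ℝ) : ℝ := (1 - 2 ^ (H - 1)) / 4

lemma lndConst_pos {H : ℝ} (hH1 : H < 1) : 0 < lndConst H := by
  have : (2 : ℝ) ^ (H - 1) < 1 := Real.rpow_lt_one_of_one_lt_of_neg (by norm_num) (by linarith)
  unfold lndConst; linarith

/-- Local nondeterminism: `Var (B_t | B_s) ≥ κ (t - s)^{2H}` for `s < t`. With `a = s^H`, `b = t^H`,
`c = (t - s)^H`, the Gram determinant `4a²b² - (a² + b² - c²)²` factors as in Heron's formula. -/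
lemma lndConst_mul_rpow_le {H : ℝ} (hH0 : 0 < H) (hH1 : H < 1) {s t : ℝ}
    (hs : 0 < s) (hst : s < t) :
    lndConst H * (t - s) ^ (2 * H) ≤ t ^ (2 * H) - fbmCov H s t ^ 2 / s ^ (2 * H) := by
  have ht : 0 < t := hs.trans hst
  have hts : 0 < t - s := sub_pos.2 hst
  have key := rpow_add_rpow_sub_sub_rpow_ge hH0 hH1 hs hst
  have hk := lndConst_pos hH1
  have sq : ∀ r : ℝ, 0 < r → r ^ (2 * H) = (r ^ H) ^ 2 := fun r hr => by
    rw [← Real.rpow_natCast, ← Real.rpow_mul hr.le]; congr 1; push_cast; ring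
  have habs : |s - t| = t - s := by rw [abs_sub_comm, abs_of_pos hts]
  rw [fbmCov, habs, sq s hs, sq t ht, sq _ hts]
  have hab : s ^ H ≤ t ^ H := Real.rpow_le_rpow hs.le hst.le hH0.le
  have hcb : (t - s) ^ H ≤ t ^ H := Real.rpow_le_rpow hts.le (by linarith) hH0.le
  have ha : 0 < s ^ H := by positivity
  have hb : 0 < t ^ H := by positivity
  have hc : 0 < (t - s) ^ H := by positivity
  have hk4 : (1 : ℝ) - 2 ^ (H - 1) = 4 * lndConst H := by unfold lndConst; ring
  rw [hk4] at key
  generalize s ^ H = a at *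
  generalize t ^ H = b at *
  generalize (t - s) ^ H = c at *
  generalize lndConst H = k at *
  have hA : b ^ 2 - (1 / 2 * (a ^ 2 + b ^ 2 - c ^ 2)) ^ 2 / a ^ 2 =
      ((a + b + c) * (a + b - c) * (c + b - a) * (a + c - b)) / (4 * a ^ 2) := by
    field_simp; ring
  rw [hA, le_div_iff₀ (by positivity)]
  have h1 : b * a * c ≤ (a + b + c) * (a + b - c) * (c + b - a) :=
    mul_le_mul (mul_le_mul (by linarith) (by linarith) ha.le (by positivity)) (by linarith) hc.le
      (mul_nonneg (by positivity) (by linarith))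
  have h2 : 0 ≤ a + c - b := by
    by_contra hneg
    push Not at hneg
    nlinarith [mul_pos (mul_pos hk ha) hc]
  calc k * c ^ 2 * (4 * a ^ 2) = a * c * (4 * k * (a * c)) := by ring
    _ ≤ a * c * (b * (a + c - b)) := by gcongr
    _ = (b * a * c) * (a + c - b) := by ring
    _ ≤ _ := by gcongr

/-! ### Gaussian structure of fractional Brownian motion -/

section FractionalBrownian

variable {Ω : Type*} [MeasurableSpace Ω] {P : Measure Ω} {d : ℕ} {H : ℝ}
  {B : ℝ≥0 → Ω → EuclideanSpace ℝ (Fin d)}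

/-- Independent Gaussian coordinates make the vector-valued process jointly Gaussian. -/
lemma IsFractionalBrownian.isGaussianProcess (hB : IsFractionalBrownian H B P) :
    IsGaussianProcess B P where
  hasGaussianLaw J := by
    have h1 : ∀ i : Fin d, HasGaussianLaw (fun ω (t : J) => B t ω i) P := fun i =>
      (IsFractionalBrownianReal.isGaussianProcess (hB.coord i)).hasGaussianLaw J
    have h2 : iIndepFun (fun (i : Fin d) ω (t : J) => B t ω i) P :=
      hB.indep.comp (fun _ g (t : J) => g t) fun _ => by fun_prop
    let L : (Fin d → J → ℝ) →ₗ[ℝ] (J → EuclideanSpace ℝ (Fin d)) :=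
      { toFun x := fun t => WithLp.toLp 2 fun i => x i t
        map_add' x y := by ext; simp
        map_smul' c x := by ext; simp }
    exact (iIndepFun.hasGaussianLaw h1 h2).map_fun (LinearMap.toContinuousLinearMap L)

/-- A process equal to `B` at all times simultaneously, almost surely, is again fractional Brownian
motion. -/
lemma IsFractionalBrownian.congr {B' : ℝ≥0 → Ω → EuclideanSpace ℝ (Fin d)}
    (hB : IsFractionalBrownian H B P) (h : ∀ᵐ ω ∂P, ∀ t, B t ω = B' t ω) :
    IsFractionalBrownian H B' P where
  coord i :=
    { isGaussianProcess :=
        (IsFractionalBrownianReal.isGaussianProcess (hB.coord i)).congr fun t => by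
        filter_upwards [h] with ω hω
        rw [hω t]
      mean_zero t := by
        rw [← (hB.coord i).mean_zero t]
        refine integral_congr_ae ?_
        filter_upwards [h] with ω hω
        rw [hω t]
      covariance t s := by
        rw [← (hB.coord i).covariance t s]
        refine integral_congr_ae ?_
        filter_upwards [h] with ω hω
        rw [hω t, hω s]
      continuous_paths := by
        filter_upwards [h, (hB.coord i).continuous_paths] with ω hω hc
        simpa only [hω] using hc }
  indep := hB.indep.congr fun i => by
    filter_upwards [h] with ω hω
    funext t
    rw [hω t]

/-- Fractional Brownian motion has an everywhere continuous, measurable version, which agrees with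
it at all times simultaneously, almost surely. -/
lemma IsFractionalBrownian.exists_continuous_version (hB : IsFractionalBrownian H B P) :
    ∃ B' : ℝ≥0 → Ω → EuclideanSpace ℝ (Fin d), (∀ t, Measurable (B' t)) ∧
      (∀ ω, Continuous fun t => B' t ω) ∧ ∀ᵐ ω ∂P, ∀ t, B t ω = B' t ω := by
  have hm : ∀ t, AEMeasurable (B t) P := hB.isGaussianProcess.aemeasurable
  have hc : ∀ᵐ ω ∂P, Continuous fun t => B t ω := by
    filter_upwards [ae_all_iff.2 fun i => (hB.coord i).continuous_paths] with ω hω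
    exact (PiLp.continuous_toLp 2 _).comp (continuous_pi hω)
  let q : ℕ → ℝ≥0 := TopologicalSpace.denseSeq ℝ≥0
  have hq : ∀ᵐ ω ∂P, ∀ n, B (q n) ω = (hm (q n)).mk _ ω :=
    ae_all_iff.2 fun n => (hm (q n)).ae_eq_mk
  obtain ⟨A, hA, hAm, hPA⟩ := Filter.Eventually.exists_measurable_mem (hc.and hq)
  let B' : ℝ≥0 → Ω → EuclideanSpace ℝ (Fin d) := fun t => A.indicator (B t)
  have hcont : ∀ ω, Continuous fun t => B' t ω := fun ω => by
    by_cases hω : ω ∈ A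
    · simpa [B', hω] using (hPA ω hω).1
    · simpa [B', hω] using continuous_const
  have hqm : ∀ n, Measurable (B' (q n)) := fun n => by
    have : B' (q n) = A.indicator ((hm (q n)).mk _) := by
      funext ω
      by_cases hω : ω ∈ A
      · simp [B', hω, (hPA ω hω).2 n]
      · simp [B', hω]
    rw [this]
    exact (hm (q n)).measurable_mk.indicator hAm
  refine ⟨B', fun t => ?_, hcont, ?_⟩
  · obtain ⟨u, hu, hut⟩ := mem_closure_iff_seq_limit.1 (TopologicalSpace.denseRange_denseSeq ℝ≥0 t)
    choose k hk using hu
    refine measurable_of_tendsto_metrizable (f := fun n => B' (u n)) (fun n => ?_) ?_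
    · simpa only [← hk n] using hqm (k n)
    · rw [tendsto_pi_nhds]
      exact fun ω => ((hcont ω).tendsto t).comp hut
  · filter_upwards [hA] with ω hω t
    simp [B', hω]

lemma IsFractionalBrownian.memLp_apply (hB : IsFractionalBrownian H B P) (i : Fin d) (t : ℝ≥0) :
    MemLp (fun ω => B t ω i) 2 P :=
  ((IsFractionalBrownianReal.isGaussianProcess (hB.coord i)).hasGaussianLaw_eval t).memLp_two

lemma fbmCov_self (hH : 0 < H) (t : ℝ) : fbmCov H t t = t ^ (2 * H) := by
  rw [fbmCov, sub_self, abs_zero, Real.zero_rpow (by positivity)]; ring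

lemma fbmCov_comm (t s : ℝ) : fbmCov H t s = fbmCov H s t := by
  rw [fbmCov, fbmCov, abs_sub_comm]; ring

lemma IsFractionalBrownian.memLp_inner (hB : IsFractionalBrownian H B P)
    (u : EuclideanSpace ℝ (Fin d)) (t : ℝ≥0) : MemLp (fun ω => ⟪u, B t ω⟫) 2 P :=
  ((hB.isGaussianProcess.hasGaussianLaw_eval t).map_fun (innerSL ℝ u)).memLp_two

lemma IsFractionalBrownian.integral_inner (hB : IsFractionalBrownian H B P)
    (u : EuclideanSpace ℝ (Fin d)) (t : ℝ≥0) : ∫ ω, ⟪u, B t ω⟫ ∂P = 0 := by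
  simp only [PiLp.inner_apply, RCLike.inner_apply, conj_trivial]
  rw [integral_finsetSum]
  · simp only [integral_mul_const, (hB.coord _).mean_zero, zero_mul, Finset.sum_const_zero]
  · have := hB.isGaussianProcess.isProbabilityMeasure
    exact fun i _ => ((hB.memLp_apply i t).integrable one_le_two).mul_const _

variable [IsProbabilityMeasure P]

lemma IsFractionalBrownian.covariance_inner (hB : IsFractionalBrownian H B P)
    (u w : EuclideanSpace ℝ (Fin d)) (s t : ℝ≥0) :
    cov[fun ω => ⟪u, B s ω⟫, fun ω => ⟪w, B t ω⟫; P] = ⟪u, w⟫ * fbmCov H s t := by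
  have hm : ∀ (i : Fin d) (t : ℝ≥0), MemLp (fun ω => B t ω i) 2 P := hB.memLp_apply
  have hij : ∀ i j : Fin d, cov[fun ω => B s ω i, fun ω => B t ω j; P] =
      if i = j then fbmCov H s t else 0 := by
    intro i j
    split_ifs with h
    · subst h
      rw [covariance_eq_sub (hm i s) (hm i t)]
      have h1 := (hB.coord i).covariance s t
      have h2 := (hB.coord i).mean_zero s
      simp only [Pi.mul_apply]
      rw [h1, h2, zero_mul, sub_zero, fbmCov]
    · have hev : ∀ r : ℝ≥0, Measurable fun g : ℝ≥0 → ℝ => g r := fun r => measurable_pi_apply r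
      have := (hB.indep.indepFun h).comp (φ := fun g : ℝ≥0 → ℝ => g s)
        (ψ := fun g : ℝ≥0 → ℝ => g t) (hev s) (hev t)
      exact IndepFun.covariance_eq_zero this (hm i s) (hm j t)
  simp only [PiLp.inner_apply, RCLike.inner_apply, conj_trivial]
  rw [covariance_fun_sum_fun_sum (fun i => (hm i s).mul_const _) (fun i => (hm i t).mul_const _)]
  simp only [covariance_mul_const_left, covariance_mul_const_right, hij, ite_mul, zero_mul,
    Finset.sum_ite_eq, Finset.mem_univ, if_true]
  rw [Finset.sum_mul]
  exact Finset.sum_congr rfl fun i _ => by ring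

/-- A centred Gaussian vector with covariance `v • id` has the isotropic Gaussian density. -/
lemma map_eq_withDensity_isoGaussianPDF {W : Ω → EuclideanSpace ℝ (Fin d)} {v : ℝ} (hv : 0 < v)
    (hW : HasGaussianLaw W P) (hmean : ∀ u, ∫ ω, ⟪u, W ω⟫ ∂P = 0)
    (hvar : ∀ u, Var[fun ω => ⟪u, W ω⟫; P] = v * ‖u‖ ^ 2) :
    P.map W = volume.withDensity fun z => ENNReal.ofReal (isoGaussianPDF v z) := by
  have : IsProbabilityMeasure (P.map W) := Measure.isProbabilityMeasure_map hW.aemeasurable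
  refine eq_withDensity_isoGaussianPDF hv fun u => ?_
  rw [hW.charFun_map_eq, hmean, hvar]
  push_cast
  congr 1
  ring

lemma IsFractionalBrownian.map_eq (hB : IsFractionalBrownian H B P) (hH : 0 < H) {t : ℝ≥0}
    (ht : 0 < t) : P.map (B t) =
      volume.withDensity fun z => ENNReal.ofReal (isoGaussianPDF ((t : ℝ) ^ (2 * H)) z) := by
  have ht' : (0 : ℝ) < t := ht
  refine map_eq_withDensity_isoGaussianPDF (by positivity)
    (hB.isGaussianProcess.hasGaussianLaw_eval t) (fun u => hB.integral_inner u t) fun u => ?_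
  rw [← covariance_self (hB.memLp_inner u t).aemeasurable, hB.covariance_inner,
    real_inner_self_eq_norm_sq, fbmCov_self hH]
  ring

/-- The residual `B_t - b B_s` of the regression of `B_t` on `B_s` is independent of `B_s` and is
an isotropic Gaussian vector of variance `t^{2H} - R(s, t)² / s^{2H}`. -/
lemma IsFractionalBrownian.regression (hB : IsFractionalBrownian H B P) (hH0 : 0 < H)
    (hH1 : H < 1) {s t : ℝ≥0} (hs : 0 < s) (hst : s < t) :
    IndepFun (B s) (fun ω => B t ω - (fbmCov H s t / (s : ℝ) ^ (2 * H)) • B s ω) P ∧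
    P.map (fun ω => B t ω - (fbmCov H s t / (s : ℝ) ^ (2 * H)) • B s ω) =
      volume.withDensity fun z => ENNReal.ofReal
        (isoGaussianPDF ((t : ℝ) ^ (2 * H) - fbmCov H s t ^ 2 / (s : ℝ) ^ (2 * H)) z) := by
  have hs' : (0 : ℝ) < s := hs
  have hst' : (s : ℝ) < t := hst
  have hS : 0 < (s : ℝ) ^ (2 * H) := by positivity
  set b := fbmCov H s t / (s : ℝ) ^ (2 * H) with hb
  have hbS : b * (s : ℝ) ^ (2 * H) = fbmCov H s t := by rw [hb]; field_simp
  have hv : 0 < (t : ℝ) ^ (2 * H) - fbmCov H s t ^ 2 / (s : ℝ) ^ (2 * H) :=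
    lt_of_lt_of_le (mul_pos (lndConst_pos hH1) (Real.rpow_pos_of_pos (sub_pos.2 hst') _))
      (lndConst_mul_rpow_le hH0 hH1 hs' hst')
  let E := EuclideanSpace ℝ (Fin d)
  let L : E × E →L[ℝ] E × E := (ContinuousLinearMap.fst ℝ E E).prod
    (ContinuousLinearMap.snd ℝ E E - b • ContinuousLinearMap.fst ℝ E E)
  have hG : HasGaussianLaw (fun ω => (B s ω, B t ω - b • B s ω)) P :=
    (hB.isGaussianProcess.hasGaussianLaw_prodMk (s := s) (t := t)).map_fun L
  have hin : ∀ (w : E), (fun ω => ⟪w, B t ω - b • B s ω⟫) =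
      fun ω => ⟪w, B t ω⟫ - b * ⟪w, B s ω⟫ := fun w => by
    funext ω
    rw [inner_sub_right, real_inner_smul_right]
  have hmb : ∀ w : E, MemLp (fun ω => b * ⟪w, B s ω⟫) 2 P := fun w =>
    (hB.memLp_inner w s).const_mul b
  refine ⟨hG.indepFun_of_covariance_inner fun u w => ?_, ?_⟩
  · rw [hin, covariance_fun_sub_right (hB.memLp_inner u s) (hB.memLp_inner w t) (hmb w),
      covariance_const_mul_right, hB.covariance_inner, hB.covariance_inner, fbmCov_self hH0, ← hbS]
    ring
  · refine map_eq_withDensity_isoGaussianPDF hv hG.snd (fun u => ?_) fun u => ?_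
    · rw [hin, integral_sub ((hB.memLp_inner u t).integrable one_le_two)
        ((hmb u).integrable one_le_two), integral_const_mul, hB.integral_inner, hB.integral_inner]
      simp
    · have hsub := (hB.memLp_inner u t).sub (hmb u)
      rw [hin, ← covariance_self (by exact hsub.aemeasurable),
        covariance_fun_sub_fun_sub (hB.memLp_inner u t) (hmb u) (hB.memLp_inner u t) (hmb u)]
      simp only [covariance_const_mul_right, covariance_const_mul_left, hB.covariance_inner,
        real_inner_self_eq_norm_sq, fbmCov_self hH0, fbmCov_comm (H := H) (t : ℝ) s]
      have : fbmCov H s t ^ 2 / (s : ℝ) ^ (2 * H) = b * fbmCov H s t := by rw [hb]; ring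
      rw [this]
      linear_combination (b * ‖u‖ ^ 2) * hbS

/-- The mixed characteristic function and moment generating function of a centred Gaussian pair. -/
lemma integral_cexp_mul_I_mul_exp {X Z : Ω → ℝ} (hXZ : HasGaussianLaw (fun ω => (X ω, Z ω)) P)
    (hX0 : ∫ ω, X ω ∂P = 0) (hZ0 : ∫ ω, Z ω ∂P = 0) :
    ∫ ω, Complex.exp (X ω * Complex.I + Z ω) ∂P =
      Complex.exp ((Var[Z; P] - Var[X; P]) / 2 + cov[X, Z; P] * Complex.I) := by
  have hX2 : MemLp X 2 P := hXZ.fst.memLp_two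
  have hZ2 : MemLp Z 2 P := hXZ.snd.memLp_two
  set β := cov[X, Z; P] / Var[Z; P] with hβ
  -- also when `Var Z = 0`, where `β = 0` by convention
  have hβV : cov[X, Z; P] = β * Var[Z; P] := by
    rcases eq_or_ne Var[Z; P] 0 with h | h
    · have hz : Z =ᵐ[P] fun _ => 0 := by
        filter_upwards [ae_eq_integral_of_variance_eq_zero hZ2 h] with ω hω
        rw [hω, hZ0]
      rw [h, mul_zero, covariance]
      refine integral_eq_zero_of_ae ?_
      filter_upwards [hz] with ω hω
      simp [hZ0, hω]
    · rw [hβ]; field_simp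
  let L : ℝ × ℝ →L[ℝ] ℝ × ℝ := (ContinuousLinearMap.snd ℝ ℝ ℝ).prod
    (ContinuousLinearMap.fst ℝ ℝ ℝ - β • ContinuousLinearMap.snd ℝ ℝ ℝ)
  have hG : HasGaussianLaw (fun ω => (Z ω, X ω - β * Z ω)) P := hXZ.map_fun L
  have hbZ : MemLp (fun ω => β * Z ω) 2 P := hZ2.const_mul β
  have hind : IndepFun Z (fun ω => X ω - β * Z ω) P := by
    refine hG.indepFun_of_covariance_eq_zero ?_
    rw [covariance_fun_sub_right hZ2 hX2 hbZ, covariance_const_mul_right, covariance_comm, hβV,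
      covariance_self hZ2.aemeasurable, sub_self]
  have hW0 : ∫ ω, (X ω - β * Z ω) ∂P = 0 := by
    rw [integral_sub (hX2.integrable one_le_two) (hbZ.integrable one_le_two), integral_const_mul,
      hX0, hZ0]; simp
  have hWV : Var[fun ω => X ω - β * Z ω; P] = Var[X; P] - β ^ 2 * Var[Z; P] := by
    have hsub := hX2.sub hbZ
    rw [← covariance_self (by exact hsub.aemeasurable),
      covariance_fun_sub_fun_sub hX2 hbZ hX2 hbZ]
    simp only [covariance_const_mul_right, covariance_const_mul_left]
    rw [covariance_self hX2.aemeasurable, covariance_self hZ2.aemeasurable, covariance_comm Z X,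
      hβV]
    ring
  have hvZ : (0 : ℝ) ≤ Var[Z; P] := variance_nonneg _ _
  have h1 : ∫ ω, Complex.exp ((1 + β * Complex.I) * Z ω) ∂P =
      Complex.exp (Var[Z; P] * (1 + β * Complex.I) ^ 2 / 2) := by
    have := complexMGF_gaussianReal (X := Z) hG.fst.map_eq_gaussianReal (1 + β * Complex.I)
    rw [complexMGF] at this
    rw [this, hZ0]
    simp [Real.coe_toNNReal _ hvZ]
  have h2 : ∫ ω, Complex.exp (((X ω - β * Z ω : ℝ) : ℂ) * Complex.I) ∂P =
      Complex.exp (-((Var[X; P] - β ^ 2 * Var[Z; P] : ℝ) : ℂ) / 2) := by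
    have := hG.snd.charFun_map_eq 1
    rw [charFun_apply_real, integral_map hG.snd.aemeasurable (by fun_prop)] at this
    have e : -((Var[X; P] - β ^ 2 * Var[Z; P] : ℝ) : ℂ) / 2 =
        -(((Var[X; P] - β ^ 2 * Var[Z; P] : ℝ) : ℂ) / 2) := neg_div _ _
    rw [e]
    simpa [hW0, hWV] using this
  have h3 : ∀ ω, Complex.exp (X ω * Complex.I + Z ω) =
      Complex.exp ((1 + β * Complex.I) * Z ω) *
        Complex.exp (((X ω - β * Z ω : ℝ) : ℂ) * Complex.I) := fun ω => by
    rw [← Complex.exp_add]; congr 1; push_cast; ring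
  simp only [h3]
  have hind' := hind.comp (φ := fun z : ℝ => Complex.exp ((1 + β * Complex.I) * z))
    (ψ := fun w : ℝ => Complex.exp ((w : ℂ) * Complex.I)) (by fun_prop) (by fun_prop)
  have h4 := hind'.integral_fun_mul_eq_mul_integral
    (by exact (by fun_prop : Measurable fun z : ℝ => Complex.exp
      ((1 + β * Complex.I) * z)).comp_aemeasurable hZ2.aemeasurable |>.aestronglyMeasurable)
    (by exact (by fun_prop : Measurable fun w : ℝ => Complex.exp
      ((w : ℂ) * Complex.I)).comp_aemeasurable (hX2.sub hbZ).aemeasurable |>.aestronglyMeasurable)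
  simp only [Function.comp_apply] at h4
  rw [h4, h1, h2, ← Complex.exp_add, hβV]
  congr 1
  push_cast
  ring_nf
  rw [Complex.I_sq]
  ring

end FractionalBrownian

/-! ### The Cameron–Martin formula for one marginal -/

section CameronMartin

variable {Ω : Type*} [MeasurableSpace Ω] {P : Measure Ω} {d : ℕ} {H : ℝ}
  {B : ℝ≥0 → Ω → EuclideanSpace ℝ (Fin d)}

/-- The linear functional `∑ a_s ⟪y, B_s⟫` of the process. -/
noncomputable def linFunctional (B : ℝ≥0 → Ω → EuclideanSpace ℝ (Fin d)) (a : ℝ≥0 →₀ ℝ)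
    (y : EuclideanSpace ℝ (Fin d)) (ω : Ω) : ℝ :=
  a.sum fun s c => c * ⟪y, B s ω⟫

/-- The exponential martingale weight `exp (Z - Var Z / 2)` for `Z = ∑ a_s ⟪y, B_s⟫`. -/
noncomputable def expWeight (P : Measure Ω) (B : ℝ≥0 → Ω → EuclideanSpace ℝ (Fin d))
    (a : ℝ≥0 →₀ ℝ) (y : EuclideanSpace ℝ (Fin d)) (ω : Ω) : ℝ :=
  Real.exp (linFunctional B a y ω - Var[linFunctional B a y; P] / 2)

lemma expWeight_pos (a : ℝ≥0 →₀ ℝ) (y : EuclideanSpace ℝ (Fin d)) (ω : Ω) :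
    0 < expWeight P B a y ω :=
  Real.exp_pos _

lemma IsFractionalBrownian.hasGaussianLaw_inner_linFunctional (hB : IsFractionalBrownian H B P)
    (a : ℝ≥0 →₀ ℝ) (y u : EuclideanSpace ℝ (Fin d)) (t : ℝ≥0) :
    HasGaussianLaw (fun ω => (⟪u, B t ω⟫, linFunctional B a y ω)) P := by
  have hY : IsGaussianProcess (fun (b : Bool) ω =>
      if b then ⟪u, B t ω⟫ else linFunctional B a y ω) P := by
    refine hB.isGaussianProcess.of_isGaussianProcess fun b => ?_
    cases b
    · refine ⟨a.support, ∑ s : a.support, a s •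
        (innerSL ℝ y ∘L ContinuousLinearMap.proj s), fun ω => ?_⟩
      simp only [Bool.false_eq_true, if_false, linFunctional, Finsupp.sum]
      rw [← Finset.sum_coe_sort a.support]
      simp
    · refine ⟨{t}, innerSL ℝ u ∘L ContinuousLinearMap.proj (⟨t, by simp⟩ : ({t} : Finset ℝ≥0)),
        fun ω => ?_⟩
      simp
  simpa using hY.hasGaussianLaw_prodMk (s := true) (t := false)

lemma IsFractionalBrownian.integral_linFunctional (hB : IsFractionalBrownian H B P)
    (a : ℝ≥0 →₀ ℝ) (y : EuclideanSpace ℝ (Fin d)) : ∫ ω, linFunctional B a y ω ∂P = 0 := by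
  have := hB.isGaussianProcess.isProbabilityMeasure
  simp only [linFunctional, Finsupp.sum]
  rw [integral_finsetSum]
  · simp [integral_const_mul, hB.integral_inner]
  · exact fun s _ => ((hB.memLp_inner y s).integrable one_le_two).const_mul _

/-- The covariance of `B_t` with the functional `∑ a_s ⟪y, B_s⟫` is the vector `h(t) y` with
`h = ∑ a_s R(·, s)`. -/
lemma IsFractionalBrownian.covariance_inner_linFunctional (hB : IsFractionalBrownian H B P)
    (a : ℝ≥0 →₀ ℝ) (y u : EuclideanSpace ℝ (Fin d)) (t : ℝ≥0) :
    cov[fun ω => ⟪u, B t ω⟫, linFunctional B a y; P] = ⟪u, y⟫ * fbmComb H a t := by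
  have := hB.isGaussianProcess.isProbabilityMeasure
  have : linFunctional B a y = fun ω => ∑ s ∈ a.support, a s * ⟪y, B s ω⟫ := rfl
  rw [this, covariance_fun_sum_right' (fun s _ => (hB.memLp_inner y s).const_mul _)
    (hB.memLp_inner u t), fbmComb, Finsupp.sum, Finset.mul_sum]
  refine Finset.sum_congr rfl fun s _ => ?_
  rw [covariance_const_mul_right, hB.covariance_inner]
  ring

lemma IsFractionalBrownian.aemeasurable_linFunctional (hB : IsFractionalBrownian H B P)
    (a : ℝ≥0 →₀ ℝ) (y : EuclideanSpace ℝ (Fin d)) : AEMeasurable (linFunctional B a y) P :=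
  (hB.hasGaussianLaw_inner_linFunctional a y 0 0).snd.aemeasurable

lemma IsFractionalBrownian.aemeasurable_expWeight (hB : IsFractionalBrownian H B P)
    (a : ℝ≥0 →₀ ℝ) (y : EuclideanSpace ℝ (Fin d)) : AEMeasurable (expWeight P B a y) P :=
  ((hB.aemeasurable_linFunctional a y).sub_const _).exp

lemma IsFractionalBrownian.integrable_expWeight (hB : IsFractionalBrownian H B P)
    (a : ℝ≥0 →₀ ℝ) (y : EuclideanSpace ℝ (Fin d)) : Integrable (expWeight P B a y) P := by
  have hG := (hB.hasGaussianLaw_inner_linFunctional a y 0 0).snd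
  have h : Integrable (fun x : ℝ => Real.exp (1 * x)) (P.map (linFunctional B a y)) := by
    rw [hG.map_eq_gaussianReal]; exact integrable_exp_mul_gaussianReal 1
  have h2 := h.comp_aemeasurable hG.aemeasurable
  refine (h2.mul_const (Real.exp (-(Var[linFunctional B a y; P] / 2)))).congr
    (ae_of_all _ fun ω => ?_)
  simp [expWeight, sub_eq_add_neg, Real.exp_add]

/-- Cameron–Martin formula for one marginal: under the weight `exp (Z - Var Z / 2)`, the law of
`B_t` is translated by `Cov (B_t, Z) = h(t) y`. -/
lemma IsFractionalBrownian.map_withDensity_expWeight (hB : IsFractionalBrownian H B P)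
    (a : ℝ≥0 →₀ ℝ) (y : EuclideanSpace ℝ (Fin d)) (t : ℝ≥0) :
    (P.withDensity fun ω => ENNReal.ofReal (expWeight P B a y ω)).map (B t) =
      P.map fun ω => fbmComb H a t • y + B t ω := by
  have := hB.isGaussianProcess.isProbabilityMeasure
  have hBm : AEMeasurable (B t) P := hB.isGaussianProcess.aemeasurable t
  have hac := withDensity_absolutelyContinuous P fun ω => ENNReal.ofReal (expWeight P B a y ω)
  have : IsFiniteMeasure (P.withDensity fun ω => ENNReal.ofReal (expWeight P B a y ω)) :=
    isFiniteMeasure_withDensity_ofReal (hB.integrable_expWeight a y).2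
  have h0 : AEMeasurable (fun ω => fbmComb H a t • y + B t ω) P := by fun_prop
  have : IsProbabilityMeasure (P.map fun ω => fbmComb H a t • y + B t ω) :=
    Measure.isProbabilityMeasure_map h0
  refine Measure.ext_of_charFun (funext fun u => ?_)
  have hG := hB.hasGaussianLaw_inner_linFunctional a y u t
  have key := integral_cexp_mul_I_mul_exp hG (hB.integral_inner u t)
    (hB.integral_linFunctional a y)
  have hadd : (P.map fun ω => fbmComb H a t • y + B t ω) =
      (P.map (B t)).map fun z => fbmComb H a t • y + z := by
    rw [AEMeasurable.map_map_of_aemeasurable (by fun_prop) hBm]; rfl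
  rw [hadd, charFun_map_const_add, (hB.isGaussianProcess.hasGaussianLaw_eval t).charFun_map_eq,
    hB.integral_inner, charFun_apply, integral_map (hBm.mono_ac hac) (by fun_prop),
    integral_withDensity_eq_integral_toReal_smul₀
      (hB.aemeasurable_expWeight a y).ennreal_ofReal (ae_of_all _ fun _ => ENNReal.ofReal_lt_top)]
  have e : ∀ ω, (ENNReal.ofReal (expWeight P B a y ω)).toReal •
      Complex.exp (((⟪B t ω, u⟫ : ℝ) : ℂ) * Complex.I) =
      Complex.exp (((⟪u, B t ω⟫ : ℝ) : ℂ) * Complex.I + (linFunctional B a y ω : ℝ)) *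
        Complex.exp (-((Var[linFunctional B a y; P] / 2 : ℝ) : ℂ)) := fun ω => by
    rw [ENNReal.toReal_ofReal (expWeight_pos a y ω).le, expWeight, Complex.real_smul,
      real_inner_comm, ← Complex.exp_add, Complex.ofReal_exp, ← Complex.exp_add]
    congr 1; push_cast; ring
  simp only [e]
  rw [integral_mul_const, key, ← Complex.exp_add, ← Complex.exp_add,
    hB.covariance_inner_linFunctional, real_inner_smul_left, real_inner_comm y u]
  congr 1
  push_cast
  ring

lemma IsFractionalBrownian.integral_mul_expWeight (hB : IsFractionalBrownian H B P)
    (a : ℝ≥0 →₀ ℝ) (y : EuclideanSpace ℝ (Fin d)) (t : ℝ≥0)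
    {F : EuclideanSpace ℝ (Fin d) → ℝ} (hF : Measurable F) :
    ∫ ω, expWeight P B a y ω * F (B t ω) ∂P = ∫ ω, F (fbmComb H a t • y + B t ω) ∂P := by
  have hBm : AEMeasurable (B t) P := hB.isGaussianProcess.aemeasurable t
  have hac := withDensity_absolutelyContinuous P fun ω => ENNReal.ofReal (expWeight P B a y ω)
  rw [← integral_map (f := F) (φ := fun ω => fbmComb H a t • y + B t ω) (by fun_prop)
      hF.aestronglyMeasurable, ← hB.map_withDensity_expWeight,
    integral_map (hBm.mono_ac hac) hF.aestronglyMeasurable,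
    integral_withDensity_eq_integral_toReal_smul₀
      (hB.aemeasurable_expWeight a y).ennreal_ofReal (ae_of_all _ fun _ => ENNReal.ofReal_lt_top)]
  refine integral_congr_ae (ae_of_all _ fun ω => ?_)
  simp only [smul_eq_mul]
  rw [ENNReal.toReal_ofReal (expWeight_pos a y ω).le]

lemma IsFractionalBrownian.lintegral_mul_expWeight (hB : IsFractionalBrownian H B P)
    (a : ℝ≥0 →₀ ℝ) (y : EuclideanSpace ℝ (Fin d)) (t : ℝ≥0)
    {F : EuclideanSpace ℝ (Fin d) → ℝ≥0∞} (hF : Measurable F) :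
    ∫⁻ ω, ENNReal.ofReal (expWeight P B a y ω) * F (B t ω) ∂P =
      ∫⁻ ω, F (fbmComb H a t • y + B t ω) ∂P := by
  have hBm : AEMeasurable (B t) P := hB.isGaussianProcess.aemeasurable t
  have hac := withDensity_absolutelyContinuous P fun ω => ENNReal.ofReal (expWeight P B a y ω)
  rw [← lintegral_map' (f := F) (g := fun ω => fbmComb H a t • y + B t ω) hF.aemeasurable
      (by fun_prop), ← hB.map_withDensity_expWeight,
    lintegral_map' hF.aemeasurable (hBm.mono_ac hac),
    lintegral_withDensity_eq_lintegral_mul₀ (hB.aemeasurable_expWeight a y).ennreal_ofReal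
      (g := fun ω => F (B t ω)) (hF.comp_aemeasurable hBm)]
  rfl

lemma IsFractionalBrownian.integral_expWeight (hB : IsFractionalBrownian H B P)
    (a : ℝ≥0 →₀ ℝ) (y : EuclideanSpace ℝ (Fin d)) : ∫ ω, expWeight P B a y ω ∂P = 1 := by
  have := hB.isGaussianProcess.isProbabilityMeasure
  simpa using hB.integral_mul_expWeight a y 0 (F := fun _ => 1) measurable_const

end CameronMartin

/-! ### One-time and two-time bounds -/

lemma lintegral_ofReal_occBound_lt_top {d : ℕ} {H M N : ℝ} (hH0 : 0 < H) (hd : 1 / H < (d : ℝ))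
    (hM : 0 ≤ M) (hN : 0 ≤ N) :
    ∫⁻ u in Ioi (0 : ℝ), ENNReal.ofReal (occBound d H M N u) < ∞ :=
  (integrableOn_occBound hH0 hd hM hN).lintegral_lt_top

lemma lintegral_ofReal_occBound_abs_lt_top {d : ℕ} {H M N : ℝ} (hH0 : 0 < H)
    (hd : 1 / H < (d : ℝ)) (hM : 0 ≤ M) (hN : 0 ≤ N) :
    ∫⁻ u : ℝ, ENNReal.ofReal (occBound d H M N |u|) < ∞ := by
  have h1 : IntegrableOn (fun u => occBound d H M N |u|) (Ioi 0) :=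
    (integrableOn_occBound hH0 hd hM hN).congr_fun
      (fun u hu => by rw [abs_of_pos hu]) measurableSet_Ioi
  have h2 : IntegrableOn (fun u => occBound d H M N |u|) (Iic 0) := by
    rw [← Measure.map_neg_eq_self (volume : Measure ℝ)]
    let m : MeasurableEmbedding fun x : ℝ => -x := (Homeomorph.neg ℝ).measurableEmbedding
    rw [m.integrableOn_map_iff]
    simp_rw [Function.comp_def, abs_neg, neg_preimage, neg_Iic, neg_zero]
    exact (integrableOn_Ici_iff_integrableOn_Ioi).2 h1
  have h3 := h2.union h1
  rw [Iic_union_Ioi, integrableOn_univ] at h3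
  exact h3.lintegral_lt_top

/-- The double integral of the two-time bound is finite: bound `q (min s t)` by `q s + q t` and
integrate out the other variable. -/
lemma lintegral_lintegral_occBound_lt_top {d : ℕ} {H M N : ℝ} (hH0 : 0 < H)
    (hd : 1 / H < (d : ℝ)) (hM : 0 ≤ M) (hN : 0 ≤ N) :
    ∫⁻ s in Ioi (0 : ℝ), ∫⁻ t in Ioi (0 : ℝ), ENNReal.ofReal (occBound d H M N (min s t)) *
      ENNReal.ofReal (occBound d H M N |t - s|) < ∞ := by
  set q : ℝ → ℝ≥0∞ := fun u => ENNReal.ofReal (occBound d H M N u) with hq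
  have hqm : Measurable q := measurable_occBound.ennreal_ofReal
  set A := ∫⁻ u in Ioi (0 : ℝ), q u with hA
  set D := ∫⁻ u : ℝ, q |u| with hD
  have hA' : A < ∞ := lintegral_ofReal_occBound_lt_top hH0 hd hM hN
  have hD' : D < ∞ := lintegral_ofReal_occBound_abs_lt_top hH0 hd hM hN
  have hshift : ∀ s : ℝ, ∫⁻ t in Ioi (0 : ℝ), q |t - s| ≤ D := fun s =>
    (setLIntegral_le_lintegral _ _).trans
      (lintegral_sub_right_eq_self (fun u : ℝ => q |u|) s).le
  have hshift' : ∀ t : ℝ, ∫⁻ s in Ioi (0 : ℝ), q |t - s| ≤ D := fun t => by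
    simpa only [abs_sub_comm] using hshift t
  have h1 : ∫⁻ s in Ioi (0 : ℝ), ∫⁻ t in Ioi (0 : ℝ), q s * q |t - s| ≤ A * D := by
    rw [hA, ← lintegral_mul_const _ hqm]
    refine lintegral_mono fun s => ?_
    rw [lintegral_const_mul _ (by fun_prop)]
    gcongr
    exact hshift s
  have h2 : ∫⁻ s in Ioi (0 : ℝ), ∫⁻ t in Ioi (0 : ℝ), q t * q |t - s| ≤ A * D := by
    rw [lintegral_lintegral_swap (by fun_prop), hA, ← lintegral_mul_const _ hqm]
    refine lintegral_mono fun t => ?_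
    rw [lintegral_const_mul _ (by fun_prop)]
    gcongr
    exact hshift' t
  refine lt_of_le_of_lt ?_ (ENNReal.add_lt_top.2
    ⟨ENNReal.mul_lt_top hA' hD', ENNReal.mul_lt_top hA' hD'⟩ : A * D + A * D < ∞)
  refine le_trans ?_ (add_le_add h1 h2)
  rw [← lintegral_add_left (by fun_prop)]
  refine lintegral_mono fun s => ?_
  rw [← lintegral_add_left (by fun_prop)]
  refine lintegral_mono fun t => ?_
  rw [← add_mul]
  gcongr
  rcases le_total s t with h | h
  · simp only [min_eq_left h]; exact le_self_add
  · simp only [min_eq_right h]; exact le_add_self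

section Bounds

variable {d : ℕ} {H M : ℝ} {f : EuclideanSpace ℝ (Fin d) → ℝ}

/-- The second constant `(2πκ)^{-d/2} ‖f‖₁` in the bound for the occupation integrals. -/
noncomputable def occMass (H : ℝ) (f : EuclideanSpace ℝ (Fin d) → ℝ) : ℝ :=
  (2 * Real.pi * lndConst H) ^ (-((d : ℝ) / 2)) * ∫ z, ‖f z‖

lemma occMass_nonneg (hH1 : H < 1) : 0 ≤ occMass H f := by
  have := lndConst_pos hH1
  unfold occMass
  have : 0 ≤ ∫ z, ‖f z‖ := integral_nonneg fun _ => norm_nonneg _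
  positivity

/-- Smearing `f` with a Gaussian of variance at least `κ r^{2H}` costs at most `q(r)`, uniformly in
the centre. -/
lemma lintegral_enorm_isoGaussian_le (hH1 : H < 1) {r v : ℝ} (hr : 0 < r)
    (hv : lndConst H * r ^ (2 * H) ≤ v) (hf_cont : Continuous f) (hM : ∀ y, |f y| ≤ M)
    (hf_int : Integrable f) {μ : Measure (EuclideanSpace ℝ (Fin d))} [IsProbabilityMeasure μ]
    (hμ : μ = volume.withDensity fun z => ENNReal.ofReal (isoGaussianPDF v z))
    (y : EuclideanSpace ℝ (Fin d)) :
    ∫⁻ z, ‖f (y + z)‖ₑ ∂μ ≤ ENNReal.ofReal (occBound d H M (occMass H f) r) := by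
  have hκ := lndConst_pos hH1
  have hκr : 0 < lndConst H * r ^ (2 * H) := by positivity
  have hv0 : 0 < v := hκr.trans_le hv
  have hf_meas := hf_cont.measurable
  have hfm : Measurable fun z => ‖f (y + z)‖ₑ := by fun_prop
  rw [occBound, ENNReal.ofReal_min]
  refine le_min ?_ ?_
  · calc ∫⁻ z, ‖f (y + z)‖ₑ ∂μ ≤ ∫⁻ _, ENNReal.ofReal M ∂μ := lintegral_mono fun z => by
          rw [Real.enorm_eq_ofReal_abs]; exact ENNReal.ofReal_le_ofReal (hM _)
      _ = _ := by simp
  · rw [hμ, lintegral_withDensity_eq_lintegral_mul _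
      (continuous_isoGaussianPDF v).measurable.ennreal_ofReal hfm]
    calc ∫⁻ z, ENNReal.ofReal (isoGaussianPDF v z) * ‖f (y + z)‖ₑ
        ≤ ∫⁻ z, ENNReal.ofReal ((2 * Real.pi * v) ^ (-((d : ℝ) / 2))) * ‖f (y + z)‖ₑ := by
          refine lintegral_mono fun z => ?_
          gcongr
          exact isoGaussianPDF_le hv0.le z
      _ = ENNReal.ofReal ((2 * Real.pi * v) ^ (-((d : ℝ) / 2)) * ∫ z, ‖f z‖) := by
          rw [lintegral_const_mul _ hfm, lintegral_add_left_eq_self (fun z => ‖f z‖ₑ) y,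
            ENNReal.ofReal_mul (by positivity), ofReal_integral_norm_eq_lintegral_enorm hf_int]
      _ ≤ _ := by
          refine ENNReal.ofReal_le_ofReal ?_
          rw [occMass, mul_right_comm _ (∫ z, ‖f z‖)]
          refine mul_le_mul_of_nonneg_right ?_
            (integral_nonneg (f := fun z => ‖f z‖) fun _ => norm_nonneg _)
          have e : r ^ (-(H * d)) = (r ^ (2 * H)) ^ (-((d : ℝ) / 2)) := by
            rw [← Real.rpow_mul hr.le]; congr 1; ring
          rw [e, ← Real.mul_rpow (by positivity) (by positivity)]
          refine Real.rpow_le_rpow_of_nonpos (by positivity) ?_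
            (neg_nonpos.2 (by positivity))
          rw [mul_assoc (2 * Real.pi)]
          gcongr

variable {Ω : Type*} [MeasurableSpace Ω] {P : Measure Ω} [IsProbabilityMeasure P]
  {B : ℝ≥0 → Ω → EuclideanSpace ℝ (Fin d)}

/-- One-time bound `E |f(y + B_t)| ≤ q(t)`; it fits the two-time constants because `κ ≤ 1`. -/
lemma IsFractionalBrownian.lintegral_enorm_le (hB : IsFractionalBrownian H B P) (hH0 : 0 < H)
    (hH1 : H < 1) (hf_cont : Continuous f) (hM : ∀ y, |f y| ≤ M) (hf_int : Integrable f)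
    (y : EuclideanSpace ℝ (Fin d)) {t : ℝ} (ht : 0 < t) :
    ∫⁻ ω, ‖f (y + B t.toNNReal ω)‖ₑ ∂P ≤ ENNReal.ofReal (occBound d H M (occMass H f) t) := by
  have hf_meas := hf_cont.measurable
  have hBm := hB.isGaussianProcess.aemeasurable t.toNNReal
  have hκ1 : lndConst H ≤ 1 := by
    have : (0 : ℝ) < 2 ^ (H - 1) := by positivity
    unfold lndConst; linarith
  have : IsProbabilityMeasure (P.map (B t.toNNReal)) := Measure.isProbabilityMeasure_map hBm
  have hlaw := hB.map_eq hH0 (Real.toNNReal_pos.2 ht)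
  rw [Real.coe_toNNReal t ht.le] at hlaw
  have := lintegral_enorm_isoGaussian_le hH1 ht
    (mul_le_of_le_one_left (by positivity) hκ1) hf_cont hM hf_int hlaw y
  rwa [lintegral_map' (by fun_prop) hBm] at this

/-- Two-time bound: condition on the earlier time. -/
lemma IsFractionalBrownian.lintegral_enorm_mul_enorm_le_of_lt (hB : IsFractionalBrownian H B P)
    (hH0 : 0 < H) (hH1 : H < 1) (hf_cont : Continuous f) (hM : ∀ y, |f y| ≤ M)
    (hf_int : Integrable f) (y : EuclideanSpace ℝ (Fin d)) {s t : ℝ} (hs : 0 < s) (hst : s < t) :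
    ∫⁻ ω, ‖f (y + B s.toNNReal ω)‖ₑ * ‖f (y + B t.toNNReal ω)‖ₑ ∂P ≤
      ENNReal.ofReal (occBound d H M (occMass H f) s) *
        ENNReal.ofReal (occBound d H M (occMass H f) (t - s)) := by
  have hf_meas := hf_cont.measurable
  have ht := hs.trans hst
  obtain ⟨hind, hlaw⟩ := hB.regression hH0 hH1 (Real.toNNReal_pos.2 hs)
    ((Real.toNNReal_lt_toNNReal_iff ht).2 hst)
  set b := fbmCov H s.toNNReal t.toNNReal / (s.toNNReal : ℝ) ^ (2 * H) with hb
  have hBm := hB.isGaussianProcess.aemeasurable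
  have hWm : AEMeasurable (fun ω => B t.toNNReal ω - b • B s.toNNReal ω) P := by
    have h1 := hBm s.toNNReal
    have h2 := hBm t.toNNReal
    fun_prop
  rw [Real.coe_toNNReal t ht.le, Real.coe_toNNReal s hs.le] at hlaw
  set W := fun ω => B t.toNNReal ω - b • B s.toNNReal ω with hW
  have : IsProbabilityMeasure (P.map W) := Measure.isProbabilityMeasure_map hWm
  have : IsProbabilityMeasure (P.map (B s.toNNReal)) :=
    Measure.isProbabilityMeasure_map (hBm _)
  have hpair := (indepFun_iff_map_prod_eq_prod_map_map (hBm s.toNNReal) hWm).1 hind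
  have e : ∀ ω, ‖f (y + B s.toNNReal ω)‖ₑ * ‖f (y + B t.toNNReal ω)‖ₑ =
      (fun p : EuclideanSpace ℝ (Fin d) × EuclideanSpace ℝ (Fin d) =>
        ‖f (y + p.1)‖ₑ * ‖f ((y + b • p.1) + p.2)‖ₑ) (B s.toNNReal ω, W ω) := fun ω => by
    simp only [hW]; congr 3; abel
  simp only [e]
  have hm : Measurable (fun p : EuclideanSpace ℝ (Fin d) × EuclideanSpace ℝ (Fin d) =>
        ‖f (y + p.1)‖ₑ * ‖f ((y + b • p.1) + p.2)‖ₑ) := by fun_prop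
  rw [← lintegral_map' (f := fun p : EuclideanSpace ℝ (Fin d) × EuclideanSpace ℝ (Fin d) =>
        ‖f (y + p.1)‖ₑ * ‖f ((y + b • p.1) + p.2)‖ₑ) hm.aemeasurable ((hBm _).prodMk hWm),
    hpair, lintegral_prod _ hm.aemeasurable]
  calc _ ≤ ∫⁻ z, ‖f (y + z)‖ₑ * ENNReal.ofReal (occBound d H M (occMass H f) (t - s))
          ∂(P.map (B s.toNNReal)) := by
        refine lintegral_mono fun z => ?_
        simp only
        rw [lintegral_const_mul _ (by fun_prop)]
        gcongr
        exact lintegral_enorm_isoGaussian_le hH1 (sub_pos.2 hst)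
          (lndConst_mul_rpow_le hH0 hH1 hs hst) hf_cont hM hf_int hlaw _
    _ = (∫⁻ ω, ‖f (y + B s.toNNReal ω)‖ₑ ∂P) *
          ENNReal.ofReal (occBound d H M (occMass H f) (t - s)) := by
        rw [lintegral_mul_const _ (by fun_prop), lintegral_map' (by fun_prop) (hBm _)]
    _ ≤ _ := by
        gcongr
        exact hB.lintegral_enorm_le hH0 hH1 hf_cont hM hf_int y hs

lemma IsFractionalBrownian.lintegral_enorm_mul_enorm_le (hB : IsFractionalBrownian H B P)
    (hH0 : 0 < H) (hH1 : H < 1) (hf_cont : Continuous f) (hM : ∀ y, |f y| ≤ M)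
    (hf_int : Integrable f) (y : EuclideanSpace ℝ (Fin d)) {s t : ℝ} (hs : 0 < s) (ht : 0 < t)
    (hst : s ≠ t) :
    ∫⁻ ω, ‖f (y + B s.toNNReal ω)‖ₑ * ‖f (y + B t.toNNReal ω)‖ₑ ∂P ≤
      ENNReal.ofReal (occBound d H M (occMass H f) (min s t)) *
        ENNReal.ofReal (occBound d H M (occMass H f) |t - s|) := by
  rcases lt_or_gt_of_ne hst with h | h
  · rw [min_eq_left h.le, abs_of_pos (sub_pos.2 h)]
    exact hB.lintegral_enorm_mul_enorm_le_of_lt hH0 hH1 hf_cont hM hf_int y hs h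
  · rw [min_eq_right h.le, abs_sub_comm, abs_of_pos (sub_pos.2 h)]
    simpa only [mul_comm] using
      hB.lintegral_enorm_mul_enorm_le_of_lt hH0 hH1 hf_cont hM hf_int y ht h

end Bounds

/-! ### Moments of the perpetual integral -/

section Perpetual

variable {d : ℕ} {H M : ℝ} {f : EuclideanSpace ℝ (Fin d) → ℝ} {x : EuclideanSpace ℝ (Fin d)}
  {Ω : Type*} [MeasurableSpace Ω] {P : Measure Ω}
  {B : ℝ≥0 → Ω → EuclideanSpace ℝ (Fin d)}

lemma measurable_uncurry_toNNReal (hBm : ∀ t, Measurable (B t))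
    (hBc : ∀ ω, Continuous fun t => B t ω) :
    Measurable fun p : ℝ × Ω => B p.1.toNNReal p.2 := by
  have h := (stronglyMeasurable_uncurry_of_continuous_of_stronglyMeasurable hBc
    fun t => (hBm t).stronglyMeasurable).measurable
  exact h.comp (by fun_prop : Measurable fun p : ℝ × Ω => (p.1.toNNReal, p.2))

variable [IsProbabilityMeasure P]

/-- Absolute convergence of the weighted double integral in `(t, ω)`; by the Cameron–Martin formula
the weight only recentres `f`, and the bound `q(t)` is uniform in the centre. -/
lemma IsFractionalBrownian.integrable_expWeight_mul (hB : IsFractionalBrownian H B P)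
    (hBm : ∀ t, Measurable (B t)) (hBc : ∀ ω, Continuous fun t => B t ω)
    (hH0 : 0 < H) (hH1 : H < 1) (hd : 1 / H < (d : ℝ))
    (hf_cont : Continuous f) (hM : ∀ y, |f y| ≤ M) (hf_int : Integrable f)
    (a : ℝ≥0 →₀ ℝ) (y : EuclideanSpace ℝ (Fin d)) :
    Integrable (fun p : ℝ × Ω => expWeight P B a y p.2 * f (x + B p.1.toNNReal p.2))
      ((volume.restrict (Ioi 0)).prod P) := by
  have hM0 : 0 ≤ M := (abs_nonneg _).trans (hM 0)
  have hf_meas := hf_cont.measurable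
  have hBu := measurable_uncurry_toNNReal hBm hBc
  have hw : AEMeasurable (fun p : ℝ × Ω => expWeight P B a y p.2)
      ((volume.restrict (Ioi 0)).prod P) := (hB.aemeasurable_expWeight a y).comp_snd
  have hm : AEMeasurable (fun p : ℝ × Ω => expWeight P B a y p.2 * f (x + B p.1.toNNReal p.2))
      ((volume.restrict (Ioi 0)).prod P) :=
    hw.mul (hf_meas.comp (hBu.const_add x)).aemeasurable
  refine ⟨hm.aestronglyMeasurable, ?_⟩
  rw [hasFiniteIntegral_iff_enorm, lintegral_prod _ hm.enorm]
  refine lt_of_le_of_lt ?_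
    (lintegral_ofReal_occBound_lt_top hH0 hd hM0 (occMass_nonneg (f := f) hH1))
  refine setLIntegral_mono' measurableSet_Ioi fun t ht => ?_
  have e : ∀ ω, ‖expWeight P B a y ω * f (x + B t.toNNReal ω)‖ₑ =
      ENNReal.ofReal (expWeight P B a y ω) * ‖f (x + B t.toNNReal ω)‖ₑ := fun ω => by
    rw [enorm_mul, Real.enorm_of_nonneg (expWeight_pos a y ω).le]
  simp only [e]
  rw [hB.lintegral_mul_expWeight a y t.toNNReal (F := fun z => ‖f (x + z)‖ₑ) (by fun_prop)]
  simp only [← add_assoc]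
  exact hB.lintegral_enorm_le hH0 hH1 hf_cont hM hf_int _ ht

lemma IsFractionalBrownian.integrable_prod (hB : IsFractionalBrownian H B P)
    (hBm : ∀ t, Measurable (B t)) (hBc : ∀ ω, Continuous fun t => B t ω)
    (hH0 : 0 < H) (hH1 : H < 1) (hd : 1 / H < (d : ℝ))
    (hf_cont : Continuous f) (hM : ∀ y, |f y| ≤ M) (hf_int : Integrable f) :
    Integrable (fun p : ℝ × Ω => f (x + B p.1.toNNReal p.2))
      ((volume.restrict (Ioi 0)).prod P) := by
  refine (hB.integrable_expWeight_mul (x := x) hBm hBc hH0 hH1 hd hf_cont hM hf_int 0 0).congr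
    (ae_of_all _ fun p => ?_)
  have h0 : linFunctional B 0 0 = fun _ => 0 := by funext ω; simp [linFunctional]
  have hv : Var[fun _ : Ω => (0 : ℝ); P] = 0 := variance_zero P
  simp [expWeight, h0, hv]

lemma IsFractionalBrownian.integral_comp_eq (hB : IsFractionalBrownian H B P) (hH0 : 0 < H)
    (hf_cont : Continuous f) (y : EuclideanSpace ℝ (Fin d)) {t : ℝ} (ht : 0 < t) :
    ∫ ω, f (y + B t.toNNReal ω) ∂P = ∫ z, isoGaussianPDF (t ^ (2 * H)) z * f (y + z) := by
  have hBm := hB.isGaussianProcess.aemeasurable t.toNNReal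
  have hlaw := hB.map_eq hH0 (Real.toNNReal_pos.2 ht)
  rw [Real.coe_toNNReal t ht.le] at hlaw
  have hc : Continuous fun z => f (y + z) := by fun_prop
  rw [← integral_map (f := fun z => f (y + z)) hBm hc.aestronglyMeasurable, hlaw,
    integral_withDensity_eq_integral_toReal_smul₀
      (continuous_isoGaussianPDF _).measurable.ennreal_ofReal.aemeasurable
      (ae_of_all _ fun _ => ENNReal.ofReal_lt_top)]
  refine integral_congr_ae (ae_of_all _ fun z => ?_)
  simp only [smul_eq_mul]
  rw [ENNReal.toReal_ofReal (isoGaussianPDF_nonneg (by positivity) z)]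

/-- Absolute convergence of the double integral in `(t, z)`. With Tonelli it also yields the
integrability of `f` against the Riesz kernel. -/
lemma IsFractionalBrownian.integrable_isoGaussianPDF_mul (hB : IsFractionalBrownian H B P)
    (hH0 : 0 < H) (hH1 : H < 1) (hd : 1 / H < (d : ℝ))
    (hf_cont : Continuous f) (hM : ∀ y, |f y| ≤ M) (hf_int : Integrable f) :
    Integrable (fun p : ℝ × EuclideanSpace ℝ (Fin d) =>
      isoGaussianPDF (p.1 ^ (2 * H)) p.2 * f (x + p.2))
      ((volume.restrict (Ioi (0 : ℝ))).prod volume) := by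
  have hM0 : 0 ≤ M := (abs_nonneg _).trans (hM 0)
  have hf_meas := hf_cont.measurable
  have hp : Measurable fun p : ℝ × EuclideanSpace ℝ (Fin d) =>
      isoGaussianPDF (p.1 ^ (2 * H)) p.2 :=
    measurable_isoGaussianPDF.comp (by fun_prop :
      Measurable fun p : ℝ × EuclideanSpace ℝ (Fin d) => (p.1 ^ (2 * H), p.2))
  have hm : Measurable (fun p : ℝ × EuclideanSpace ℝ (Fin d) =>
      isoGaussianPDF (p.1 ^ (2 * H)) p.2 * f (x + p.2)) := hp.mul (by fun_prop)
  refine ⟨hm.aestronglyMeasurable, ?_⟩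
  rw [hasFiniteIntegral_iff_enorm, lintegral_prod _ hm.enorm.aemeasurable]
  refine lt_of_le_of_lt ?_
    (lintegral_ofReal_occBound_lt_top hH0 hd hM0 (occMass_nonneg (f := f) hH1))
  refine setLIntegral_mono' measurableSet_Ioi fun t ht => ?_
  have ht : 0 < t := ht
  have hBt := hB.isGaussianProcess.aemeasurable t.toNNReal
  have hlaw := hB.map_eq hH0 (Real.toNNReal_pos.2 ht)
  rw [Real.coe_toNNReal t ht.le] at hlaw
  refine le_trans (le_of_eq ?_) (hB.lintegral_enorm_le hH0 hH1 hf_cont hM hf_int x ht)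
  rw [← lintegral_map' (f := fun z => ‖f (x + z)‖ₑ) (by fun_prop) hBt, hlaw,
    lintegral_withDensity_eq_lintegral_mul _
      (continuous_isoGaussianPDF _).measurable.ennreal_ofReal (by fun_prop)]
  refine lintegral_congr fun z => ?_
  rw [Pi.mul_apply, enorm_mul, Real.enorm_of_nonneg (isoGaussianPDF_nonneg (by positivity) z)]

lemma fbmConstant_pos (hH0 : 0 < H) (hd : 1 / H < (d : ℝ)) : 0 < fbmConstant d H := by
  have := Real.Gamma_pos_of_pos (half_sub_pos hH0 hd)
  unfold fbmConstant
  positivity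

lemma nontrivial_euclideanSpace_of_inv_lt (hH0 : 0 < H) (hd : 1 / H < (d : ℝ)) :
    Nontrivial (EuclideanSpace ℝ (Fin d)) := by
  have h : (0 : ℝ) < d := lt_trans (by positivity) hd
  have h' : 0 < d := by exact_mod_cast h
  have : Nonempty (Fin d) := ⟨⟨0, h'⟩⟩
  infer_instance

/-- Almost every `z` is nonzero, where the occupation density is the Riesz kernel. -/
lemma ae_integral_isoGaussianPDF_mul (hH0 : 0 < H) (hd : 1 / H < (d : ℝ)) :
    ∀ᵐ z : EuclideanSpace ℝ (Fin d), ∫ t in Ioi (0 : ℝ), isoGaussianPDF (t ^ (2 * H)) z * f (x + z)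
      = fbmConstant d H * (f (x + z) / ‖z‖ ^ ((d : ℝ) - 1 / H)) := by
  have := nontrivial_euclideanSpace_of_inv_lt hH0 hd
  filter_upwards [Measure.ae_ne volume (0 : EuclideanSpace ℝ (Fin d))] with z hz
  rw [integral_mul_const, integral_rpow_isoGaussianPDF hH0 hd hz]
  ring

lemma IsFractionalBrownian.integrable_riesz (hB : IsFractionalBrownian H B P)
    (hH0 : 0 < H) (hH1 : H < 1) (hd : 1 / H < (d : ℝ))
    (hf_cont : Continuous f) (hM : ∀ y, |f y| ≤ M) (hf_int : Integrable f) :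
    Integrable (fun y : EuclideanSpace ℝ (Fin d) => f (x + y) / ‖y‖ ^ ((d : ℝ) - 1 / H)) := by
  have h := (hB.integrable_isoGaussianPDF_mul (x := x) hH0 hH1 hd hf_cont hM
    hf_int).integral_prod_right
  have h2 := (h.congr (ae_integral_isoGaussianPDF_mul hH0 hd)).const_mul (fbmConstant d H)⁻¹
  refine h2.congr (ae_of_all _ fun z => ?_)
  exact inv_mul_cancel_left₀ (fbmConstant_pos hH0 hd).ne' _

lemma IsFractionalBrownian.integral_perpetualIntegral (hB : IsFractionalBrownian H B P)
    (hBm : ∀ t, Measurable (B t)) (hBc : ∀ ω, Continuous fun t => B t ω)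
    (hH0 : 0 < H) (hH1 : H < 1) (hd : 1 / H < (d : ℝ))
    (hf_cont : Continuous f) (hM : ∀ y, |f y| ≤ M) (hf_int : Integrable f) :
    ∫ ω, perpetualIntegral f x B ω ∂P = fbmConstant d H *
        ∫ y : EuclideanSpace ℝ (Fin d), f (x + y) / ‖y‖ ^ ((d : ℝ) - 1 / H) := by
  have h1 := hB.integrable_prod (x := x) hBm hBc hH0 hH1 hd hf_cont hM hf_int
  have h2 := hB.integrable_isoGaussianPDF_mul (x := x) hH0 hH1 hd hf_cont hM hf_int
  calc ∫ ω, perpetualIntegral f x B ω ∂P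
      = ∫ t in Ioi (0 : ℝ), ∫ ω, f (x + B t.toNNReal ω) ∂P :=
        (integral_integral_swap (f := fun t ω => f (x + B (Real.toNNReal t) ω)) h1).symm
    _ = ∫ t in Ioi (0 : ℝ), ∫ z, isoGaussianPDF (t ^ (2 * H)) z * f (x + z) :=
        setIntegral_congr_fun measurableSet_Ioi fun t ht => hB.integral_comp_eq hH0 hf_cont x ht
    _ = ∫ z, ∫ t in Ioi (0 : ℝ), isoGaussianPDF (t ^ (2 * H)) z * f (x + z) :=
        integral_integral_swap (f := fun t z => isoGaussianPDF (t ^ (2 * H)) z * f (x + z)) h2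
    _ = _ := by
        rw [integral_congr_ae (ae_integral_isoGaussianPDF_mul hH0 hd), integral_const_mul]

lemma IsFractionalBrownian.integrable_perpetualIntegral (hB : IsFractionalBrownian H B P)
    (hBm : ∀ t, Measurable (B t)) (hBc : ∀ ω, Continuous fun t => B t ω)
    (hH0 : 0 < H) (hH1 : H < 1) (hd : 1 / H < (d : ℝ))
    (hf_cont : Continuous f) (hM : ∀ y, |f y| ≤ M) (hf_int : Integrable f) :
    Integrable (perpetualIntegral f x B) P :=
  (hB.integrable_prod (x := x) hBm hBc hH0 hH1 hd hf_cont hM hf_int).integral_prod_right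

lemma IsFractionalBrownian.memLp_perpetualIntegral (hB : IsFractionalBrownian H B P)
    (hBm : ∀ t, Measurable (B t)) (hBc : ∀ ω, Continuous fun t => B t ω)
    (hH0 : 0 < H) (hH1 : H < 1) (hd : 1 / H < (d : ℝ))
    (hf_cont : Continuous f) (hM : ∀ y, |f y| ≤ M) (hf_int : Integrable f) :
    MemLp (perpetualIntegral f x B) 2 P := by
  have hM0 : 0 ≤ M := (abs_nonneg _).trans (hM 0)
  have hf_meas := hf_cont.measurable
  have hBu := measurable_uncurry_toNNReal hBm hBc
  have hI := (hB.integrable_perpetualIntegral (x := x) hBm hBc hH0 hH1 hd hf_cont hM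
    hf_int).aestronglyMeasurable
  rw [memLp_two_iff_integrable_sq hI]
  refine ⟨hI.pow 2, ?_⟩
  rw [hasFiniteIntegral_iff_enorm]
  set ν : Measure ℝ := volume.restrict (Ioi 0) with hν
  set φ : ℝ → Ω → ℝ≥0∞ := fun t ω => ‖f (x + B t.toNNReal ω)‖ₑ with hφ
  have hφt : ∀ ω, Measurable fun t => φ t ω := fun ω => by
    have := (hBc ω).measurable
    fun_prop
  have hφm : Measurable fun q : (ℝ × ℝ) × Ω => φ q.1.1 q.2 * φ q.1.2 q.2 := by
    have h1 := hBu.comp (by fun_prop : Measurable fun q : (ℝ × ℝ) × Ω => (q.1.1, q.2))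
    have h2 := hBu.comp (by fun_prop : Measurable fun q : (ℝ × ℝ) × Ω => (q.1.2, q.2))
    exact (hf_meas.comp (h1.const_add x)).enorm.mul (hf_meas.comp (h2.const_add x)).enorm
  -- the square of a time integral is a double time integral
  have hsq : ∀ ω, ‖perpetualIntegral f x B ω ^ 2‖ₑ ≤
      ∫⁻ p, φ p.1 ω * φ p.2 ω ∂(ν.prod ν) := fun ω => by
    rw [lintegral_prod_mul (hφt ω).aemeasurable (hφt ω).aemeasurable, enorm_pow, sq]
    exact mul_le_mul' (enorm_integral_le_lintegral_enorm _) (enorm_integral_le_lintegral_enorm _)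
  refine (lintegral_mono hsq).trans_lt ?_
  rw [lintegral_lintegral_swap (by exact (hφm.comp measurable_swap).aemeasurable),
    lintegral_prod _ (by exact hφm.lintegral_prod_right'.aemeasurable)]
  refine lt_of_le_of_lt ?_
    (lintegral_lintegral_occBound_lt_top hH0 hd hM0 (occMass_nonneg (f := f) hH1))
  refine setLIntegral_mono' measurableSet_Ioi fun s hs => lintegral_mono_ae ?_
  filter_upwards [ae_restrict_mem measurableSet_Ioi,
    ae_restrict_of_ae (Measure.ae_ne volume s)] with t ht hst
  exact hB.lintegral_enorm_mul_enorm_le hH0 hH1 hf_cont hM hf_int x hs ht hst.symm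

end Perpetual

/-! ### Non-constancy -/

section Nonconstant

variable {d : ℕ} {H M : ℝ} {f : EuclideanSpace ℝ (Fin d) → ℝ} {x : EuclideanSpace ℝ (Fin d)}
  {Ω : Type*} [MeasurableSpace Ω] {P : Measure Ω}
  {B : ℝ≥0 → Ω → EuclideanSpace ℝ (Fin d)}

/-- The smoothed function `g(t, z) = E f(x + z + B_t)`. -/
noncomputable def smoothed (P : Measure Ω) (B : ℝ≥0 → Ω → EuclideanSpace ℝ (Fin d))
    (f : EuclideanSpace ℝ (Fin d) → ℝ) (x : EuclideanSpace ℝ (Fin d)) (t : ℝ)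
    (z : EuclideanSpace ℝ (Fin d)) : ℝ :=
  ∫ ω, f (x + z + B t.toNNReal ω) ∂P

lemma measurable_smoothed [SFinite P] (hBm : ∀ t, Measurable (B t))
    (hBc : ∀ ω, Continuous fun t => B t ω) (hf_cont : Continuous f) :
    Measurable fun q : ℝ × EuclideanSpace ℝ (Fin d) => smoothed P B f x q.1 q.2 := by
  have hBu := measurable_uncurry_toNNReal hBm hBc
  have h1 := hBu.comp (by fun_prop : Measurable fun q : (ℝ × EuclideanSpace ℝ (Fin d)) × Ω =>
    (q.1.1, q.2))
  have h2 : Measurable fun q : (ℝ × EuclideanSpace ℝ (Fin d)) × Ω =>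
      f (x + q.1.2 + B q.1.1.toNNReal q.2) :=
    hf_cont.measurable.comp ((by fun_prop : Measurable fun q :
      (ℝ × EuclideanSpace ℝ (Fin d)) × Ω => x + q.1.2).add h1)
  exact h2.stronglyMeasurable.integral_prod_right'.measurable

lemma IsFractionalBrownian.ae_zero (hB : IsFractionalBrownian H B P) (hH0 : 0 < H) :
    ∀ᵐ ω ∂P, B 0 ω = 0 := by
  have h : ∀ i : Fin d, ∀ᵐ ω ∂P, B 0 ω i = 0 := fun i => by
    have hm : MemLp (fun ω => B 0 ω i) 2 P := hB.memLp_apply i 0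
    have hc := (hB.coord i).covariance 0 0
    simp only [NNReal.coe_zero, sub_zero, abs_zero,
      Real.zero_rpow (by positivity : 2 * H ≠ 0), add_zero, mul_zero] at hc
    have h0 := (integral_eq_zero_iff_of_nonneg (fun ω => mul_self_nonneg _)
      (hm.integrable_mul hm)).1 hc
    filter_upwards [h0] with ω hω
    simpa using hω
  filter_upwards [ae_all_iff.2 h] with ω hω
  ext i
  simpa using hω i

variable [IsProbabilityMeasure P]

lemma continuous_smoothed (hBm : ∀ t, Measurable (B t)) (hf_cont : Continuous f)
    (hM : ∀ y, |f y| ≤ M) (t : ℝ) : Continuous (smoothed P B f x t) := by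
  refine continuous_of_dominated (bound := fun _ => M) (fun z => ?_)
    (fun z => ae_of_all _ fun ω => hM _) (integrable_const M) (ae_of_all _ fun ω => by fun_prop)
  have := hBm t.toNNReal
  have hf_meas := hf_cont.measurable
  exact (by fun_prop : Measurable fun ω => f (x + z + B t.toNNReal ω)).aestronglyMeasurable

lemma abs_smoothed_le (hM : ∀ y, |f y| ≤ M) (t : ℝ) (z : EuclideanSpace ℝ (Fin d)) :
    |smoothed P B f x t z| ≤ M := by
  simpa [smoothed] using norm_integral_le_of_norm_le_const (μ := P)
    (f := fun ω => f (x + z + B t.toNNReal ω)) (ae_of_all _ fun ω => hM _)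

lemma IsFractionalBrownian.abs_smoothed_le_occBound (hB : IsFractionalBrownian H B P)
    (hH0 : 0 < H) (hH1 : H < 1)
    (hf_cont : Continuous f) (hM : ∀ y, |f y| ≤ M) (hf_int : Integrable f)
    {t : ℝ} (ht : 0 < t) (z : EuclideanSpace ℝ (Fin d)) :
    |smoothed P B f x t z| ≤ occBound d H M (occMass H f) t := by
  have hM0 : 0 ≤ M := (abs_nonneg _).trans (hM 0)
  have h := (enorm_integral_le_lintegral_enorm (μ := P)
    fun ω => f (x + z + B t.toNNReal ω)).trans
    (hB.lintegral_enorm_le hH0 hH1 hf_cont hM hf_int (x + z) ht)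
  rw [Real.enorm_eq_ofReal_abs] at h
  exact (ENNReal.ofReal_le_ofReal_iff
    (occBound_nonneg hM0 (occMass_nonneg hH1) ht.le)).1 h

/-- `g(t, n y) → 0`: the Gaussian bump carries its mass away from that of `f`. -/
lemma IsFractionalBrownian.tendsto_smoothed_natCast_smul (hB : IsFractionalBrownian H B P)
    (hH0 : 0 < H) (hf_cont : Continuous f) (hf_int : Integrable f)
    {t : ℝ} (ht : 0 < t) {y : EuclideanSpace ℝ (Fin d)} (hy : y ≠ 0) :
    Tendsto (fun n : ℕ => smoothed P B f x t ((n : ℝ) • y)) atTop (𝓝 0) := by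
  set v := t ^ (2 * H) with hv
  have hv0 : 0 < v := by positivity
  have e : ∀ n : ℕ, smoothed P B f x t ((n : ℝ) • y) =
      ∫ w, isoGaussianPDF v (w - (x + (n : ℝ) • y)) * f w := fun n => by
    rw [smoothed, hB.integral_comp_eq hH0 hf_cont _ ht,
      ← integral_sub_right_eq_self _ (x + (n : ℝ) • y)]
    simp [hv]
  simp only [e]
  have hlim := tendsto_integral_of_dominated_convergence (μ := volume)
    (F := fun (n : ℕ) w => isoGaussianPDF v (w - (x + (n : ℝ) • y)) * f w) (f := fun _ => 0)
    (fun w => (2 * Real.pi * v) ^ (-((d : ℝ) / 2)) * ‖f w‖) (fun n => ?_)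
    (hf_int.norm.const_mul _) (fun n => ae_of_all _ fun w => ?_) (ae_of_all _ fun w => ?_)
  · simpa using hlim
  · exact (((continuous_isoGaussianPDF v).comp (by fun_prop)).mul hf_cont).aestronglyMeasurable
  · rw [norm_mul, Real.norm_of_nonneg (isoGaussianPDF_nonneg hv0.le _)]
    exact mul_le_mul_of_nonneg_right (isoGaussianPDF_le hv0.le _) (norm_nonneg _)
  · have hnorm : Tendsto (fun n : ℕ => ‖w - (x + (n : ℝ) • y)‖) atTop atTop := by
      have h1 : Tendsto (fun n : ℕ => (n : ℝ) * ‖y‖ - ‖w - x‖) atTop atTop :=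
        tendsto_atTop_add_const_right _ _
          (tendsto_natCast_atTop_atTop.atTop_mul_const (norm_pos_iff.2 hy))
      refine tendsto_atTop_mono (fun n => ?_) h1
      have := norm_sub_norm_le ((n : ℝ) • y) (w - x)
      have e : (n : ℝ) • y - (w - x) = -(w - (x + (n : ℝ) • y)) := by abel
      rwa [norm_smul, Real.norm_natCast, e, norm_neg] at this
    have h2 : Tendsto (fun n : ℕ => isoGaussianPDF v (w - (x + (n : ℝ) • y))) atTop (𝓝 0) := by
      unfold isoGaussianPDF
      rw [← mul_zero ((2 * Real.pi * v) ^ (-((d : ℝ) / 2)))]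
      refine Tendsto.const_mul _ (Real.tendsto_exp_atBot.comp ?_)
      refine Tendsto.const_mul_atTop_of_neg (by simpa using hv0) ?_
      exact (tendsto_pow_atTop two_ne_zero).comp hnorm
    simpa using h2.mul_const (f w)

lemma IsFractionalBrownian.tendsto_smoothed_zero (hB : IsFractionalBrownian H B P)
    (hBm : ∀ t, Measurable (B t)) (hBc : ∀ ω, Continuous fun t => B t ω)
    (hH0 : 0 < H) (hf_cont : Continuous f) (hM : ∀ y, |f y| ≤ M)
    (y : EuclideanSpace ℝ (Fin d)) :
    Tendsto (fun t => smoothed P B f x t y) (𝓝 0) (𝓝 (f (x + y))) := by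
  have hf_meas := hf_cont.measurable
  have hlim := tendsto_integral_filter_of_dominated_convergence (μ := P) (l := 𝓝 (0 : ℝ))
    (F := fun t ω => f (x + y + B t.toNNReal ω)) (f := fun _ => f (x + y))
    (fun _ => M) (Eventually.of_forall fun t => ?_)
    (Eventually.of_forall fun t => ae_of_all _ fun ω => hM _) (integrable_const M) ?_
  · simpa [smoothed] using hlim
  · have := hBm t.toNNReal
    exact (by fun_prop : Measurable fun ω => f (x + y + B t.toNNReal ω)).aestronglyMeasurable
  · filter_upwards [hB.ae_zero hH0] with ω hω
    have hc : Continuous fun t : ℝ => f (x + y + B t.toNNReal ω) := by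
      have := (hBc ω).comp continuous_real_toNNReal
      exact hf_cont.comp (continuous_const.add this)
    simpa [hω] using hc.tendsto 0

/-- If the perpetual integral is almost surely equal to `c`, testing it against exponential weights
gives `∫₀^∞ g(t, h(t) y) dt = c` for every `h` in the span of the functions `R(·, s)`. -/
lemma IsFractionalBrownian.integral_smoothed_fbmComb (hB : IsFractionalBrownian H B P)
    (hBm : ∀ t, Measurable (B t)) (hBc : ∀ ω, Continuous fun t => B t ω)
    (hH0 : 0 < H) (hH1 : H < 1) (hd : 1 / H < (d : ℝ))
    (hf_cont : Continuous f) (hM : ∀ y, |f y| ≤ M) (hf_int : Integrable f) {c : ℝ}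
    (hc : ∀ᵐ ω ∂P, perpetualIntegral f x B ω = c) (a : ℝ≥0 →₀ ℝ)
    (y : EuclideanSpace ℝ (Fin d)) :
    ∫ t in Ioi (0 : ℝ), smoothed P B f x t (fbmComb H a t • y) = c := by
  have h1 := hB.integrable_expWeight_mul (x := x) hBm hBc hH0 hH1 hd hf_cont hM hf_int a y
  have h2 : ∫ ω, (∫ t in Ioi (0 : ℝ), expWeight P B a y ω * f (x + B t.toNNReal ω)) ∂P = c := by
    simp only [integral_const_mul]
    have : ∀ᵐ ω ∂P, expWeight P B a y ω * ∫ t in Ioi (0 : ℝ), f (x + B t.toNNReal ω) =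
        expWeight P B a y ω * c := by
      filter_upwards [hc] with ω hω
      rw [← hω]; rfl
    rw [integral_congr_ae this, integral_mul_const, hB.integral_expWeight, one_mul]
  rw [← h2, ← integral_integral_swap
    (f := fun t ω => expWeight P B a y ω * f (x + B (Real.toNNReal t) ω)) h1]
  refine setIntegral_congr_fun measurableSet_Ioi fun t ht => ?_
  have ht : 0 < t := ht
  have := hB.integral_mul_expWeight a y t.toNNReal (F := fun z => f (x + z))
    (hf_cont.comp (by fun_prop : Continuous fun z => x + z)).measurable
  simp only [this, smoothed, Real.coe_toNNReal t ht.le, add_assoc]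

/-- By density of the span of the `R(·, s)` and dominated convergence, the identity
`∫₀^∞ g(t, ψ(t) y) dt = c` extends to all bounded measurable `ψ`. -/
lemma IsFractionalBrownian.integral_smoothed_eq (hB : IsFractionalBrownian H B P)
    (hBm : ∀ t, Measurable (B t)) (hBc : ∀ ω, Continuous fun t => B t ω)
    (hH0 : 0 < H) (hH1 : H < 1) (hd : 1 / H < (d : ℝ))
    (hf_cont : Continuous f) (hM : ∀ y, |f y| ≤ M) (hf_int : Integrable f) {c : ℝ}
    (hc : ∀ᵐ ω ∂P, perpetualIntegral f x B ω = c) (y : EuclideanSpace ℝ (Fin d))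
    {ψ : ℝ → ℝ} (hψ : Measurable ψ) {K : ℝ} (hψK : ∀ t, |ψ t| ≤ K) :
    ∫ t in Ioi (0 : ℝ), smoothed P B f x t (ψ t • y) = c := by
  have hM0 : 0 ≤ M := (abs_nonneg _).trans (hM 0)
  have h2 : MemLp (fun t : ℝ => Real.exp (-t / 2) * ψ t) 2 (volume.restrict (Ioi 0)) := by
    have h1 : MemLp (fun t : ℝ => Real.exp (-t / 2) * K) 2 (volume.restrict (Ioi 0)) := by
      simpa using (memLp_exp_mul_rpow le_rfl).mul_const K
    refine h1.mono (by fun_prop) (ae_of_all _ fun t => ?_)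
    rw [norm_mul, norm_mul]
    exact mul_le_mul_of_nonneg_left ((hψK t).trans (le_abs_self _)) (norm_nonneg _)
  obtain ⟨a, ha⟩ := exists_fbmComb_tendsto_ae hH0 hH1 h2
  have hlim := tendsto_integral_of_dominated_convergence (μ := volume.restrict (Ioi (0 : ℝ)))
    (F := fun n t => smoothed P B f x t (fbmComb H (a n) t • y))
    (f := fun t => smoothed P B f x t (ψ t • y)) (occBound d H M (occMass H f)) (fun n => ?_)
    (integrableOn_occBound hH0 hd hM0 (occMass_nonneg hH1)) (fun n => ?_) ?_
  · simp only [hB.integral_smoothed_fbmComb hBm hBc hH0 hH1 hd hf_cont hM hf_int hc] at hlim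
    exact tendsto_nhds_unique hlim tendsto_const_nhds
  · have hcomb : Measurable (fbmComb H (a n)) := by
      unfold fbmComb Finsupp.sum
      exact Finset.measurable_fun_sum _ fun s _ =>
        (continuous_fbmCov hH0 (s : ℝ)).measurable.const_mul _
    exact ((measurable_smoothed hBm hBc hf_cont).comp
      (by fun_prop : Measurable fun t => (t, fbmComb H (a n) t • y))).aestronglyMeasurable
  · filter_upwards [ae_restrict_mem measurableSet_Ioi] with t ht
    exact hB.abs_smoothed_le_occBound hH0 hH1 hf_cont hM hf_int ht _
  · filter_upwards [ha] with t ht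
    exact ((continuous_smoothed hBm hf_cont hM t).tendsto _).comp (ht.smul_const y)

/-- Letting the path sit at `y` up to time `ε` and escape to infinity afterwards leaves only
`∫₀^ε g(t, y) dt`. -/
lemma IsFractionalBrownian.setIntegral_smoothed_eq (hB : IsFractionalBrownian H B P)
    (hBm : ∀ t, Measurable (B t)) (hBc : ∀ ω, Continuous fun t => B t ω)
    (hH0 : 0 < H) (hH1 : H < 1) (hd : 1 / H < (d : ℝ))
    (hf_cont : Continuous f) (hM : ∀ y, |f y| ≤ M) (hf_int : Integrable f) {c : ℝ}
    (hc : ∀ᵐ ω ∂P, perpetualIntegral f x B ω = c) {y : EuclideanSpace ℝ (Fin d)} (hy : y ≠ 0)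
    (ε : ℝ) :
    ∫ t in Ioc 0 ε, smoothed P B f x t y = c := by
  have hM0 : 0 ≤ M := (abs_nonneg _).trans (hM 0)
  let ψ : ℕ → ℝ → ℝ := fun n t => if t ≤ ε then 1 else n
  have hψ : ∀ n, Measurable (ψ n) := fun n =>
    Measurable.ite measurableSet_Iic measurable_const measurable_const
  have hψK : ∀ n t, |ψ n t| ≤ 1 + n := fun n t => by
    have : (0 : ℝ) ≤ n := n.cast_nonneg
    simp only [ψ]
    split_ifs
    · rw [abs_one]; linarith
    · rw [abs_of_nonneg this]; linarith
  have hlim := tendsto_integral_of_dominated_convergence (μ := volume.restrict (Ioi (0 : ℝ)))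
    (F := fun n t => smoothed P B f x t (ψ n t • y))
    (f := (Iic ε).indicator fun t => smoothed P B f x t y)
    (occBound d H M (occMass H f)) (fun n => ?_)
    (integrableOn_occBound hH0 hd hM0 (occMass_nonneg hH1)) (fun n => ?_) ?_
  · simp only [hB.integral_smoothed_eq hBm hBc hH0 hH1 hd hf_cont hM hf_int hc y (hψ _) (hψK _)]
      at hlim
    have := tendsto_nhds_unique hlim tendsto_const_nhds
    rwa [setIntegral_indicator measurableSet_Iic, Ioi_inter_Iic] at this
  · have := hψ n
    exact ((measurable_smoothed hBm hBc hf_cont).comp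
      (by fun_prop : Measurable fun t => (t, ψ n t • y))).aestronglyMeasurable
  · filter_upwards [ae_restrict_mem measurableSet_Ioi] with t ht
    exact hB.abs_smoothed_le_occBound hH0 hH1 hf_cont hM hf_int ht _
  · filter_upwards [ae_restrict_mem measurableSet_Ioi] with t ht
    by_cases h : t ≤ ε
    · simp [ψ, h]
    · simpa [ψ, h] using hB.tendsto_smoothed_natCast_smul (x := x) hH0 hf_cont hf_int ht hy

/-- A perpetual integral that is almost surely constant comes from `f = 0`. -/
lemma IsFractionalBrownian.eq_zero_of_ae_eq_const (hB : IsFractionalBrownian H B P)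
    (hBm : ∀ t, Measurable (B t)) (hBc : ∀ ω, Continuous fun t => B t ω)
    (hH0 : 0 < H) (hH1 : H < 1) (hd : 1 / H < (d : ℝ))
    (hf_cont : Continuous f) (hM : ∀ y, |f y| ≤ M) (hf_int : Integrable f) {c : ℝ}
    (hc : ∀ᵐ ω ∂P, perpetualIntegral f x B ω = c) : f = 0 := by
  have hnt := nontrivial_euclideanSpace_of_inv_lt hH0 hd
  have hM0 : 0 ≤ M := (abs_nonneg _).trans (hM 0)
  have key : ∀ y : EuclideanSpace ℝ (Fin d), y ≠ 0 → f (x + y) = 0 := by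
    intro y hy
    have hI := fun ε => hB.setIntegral_smoothed_eq hBm hBc hH0 hH1 hd hf_cont hM hf_int hc hy ε
    -- the integral over the empty interval `(0, 0]`
    have hc0 : c = 0 := by simpa using (hI 0).symm
    have hint : ∀ ε : ℝ, IntegrableOn (fun t => smoothed P B f x t y) (Ioc 0 ε) := fun ε => by
      refine (integrable_const M).mono' ((measurable_smoothed hBm hBc hf_cont).comp
        (by fun_prop : Measurable fun t : ℝ => (t, y))).aestronglyMeasurable
        (ae_of_all _ fun t => abs_smoothed_le hM t y)
    refine abs_eq_zero.1 (le_antisymm (le_of_forall_pos_le_add fun δ hδ => ?_) (abs_nonneg _))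
    obtain ⟨ε, hε, hball⟩ := Metric.tendsto_nhds_nhds.1
      (hB.tendsto_smoothed_zero (x := x) hBm hBc hH0 hf_cont hM y) δ hδ
    have hε2 : 0 < ε / 2 := by positivity
    have hb := norm_setIntegral_le_of_norm_le_const (μ := volume) (s := Ioc 0 (ε / 2))
      (f := fun t => smoothed P B f x t y - f (x + y)) (C := δ) (by simp) fun t ht => by
        have := hball (x := t) (by
          rw [dist_zero_right, Real.norm_eq_abs, abs_of_pos ht.1]; linarith [ht.2])
        rw [Real.dist_eq] at this
        exact this.le
    rw [integral_sub (hint _) (by simp), hI, hc0, setIntegral_const, zero_sub, norm_neg,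
      measureReal_def, Real.volume_Ioc, sub_zero, ENNReal.toReal_ofReal hε2.le, smul_eq_mul,
      norm_mul, Real.norm_of_nonneg hε2.le, Real.norm_eq_abs, mul_comm δ] at hb
    rw [zero_add]
    exact le_of_mul_le_mul_left hb hε2
  have hd : Dense ({x}ᶜ : Set (EuclideanSpace ℝ (Fin d))) := dense_compl_singleton x
  refine Continuous.ext_on hd hf_cont continuous_const fun w hw => ?_
  have := key (w - x) (sub_ne_zero.2 hw)
  simpa using this

end Nonconstant

theorem theorem2 {Ω : Type*} [MeasurableSpace Ω] (P : Measure Ω) [IsProbabilityMeasure P]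
    (d : ℕ) (H : ℝ) (hH0 : 0 < H) (hH1 : H < 1) (hd : 1 / H < (d : ℝ))
    (B : ℝ≥0 → Ω → EuclideanSpace ℝ (Fin d)) (hB : IsFractionalBrownian H B P)
    (x : EuclideanSpace ℝ (Fin d))
    (f : EuclideanSpace ℝ (Fin d) → ℝ) (hf_cont : Continuous f)
    (hf_bdd : ∃ M : ℝ, ∀ y, |f y| ≤ M) (hf_int : Integrable f) :
    (∀ᵐ ω ∂P, IntegrableOn (fun t : ℝ => f (x + B t.toNNReal ω)) (Ioi 0)) ∧
    Integrable (perpetualIntegral f x B) P ∧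
    Integrable (fun y : EuclideanSpace ℝ (Fin d) => f (x + y) / ‖y‖ ^ ((d : ℝ) - 1 / H)) ∧
    ∫ ω, perpetualIntegral f x B ω ∂P =
      fbmConstant d H *
        ∫ y : EuclideanSpace ℝ (Fin d), f (x + y) / ‖y‖ ^ ((d : ℝ) - 1 / H) ∧
    (f ≠ 0 →
      (¬ ∃ c : ℝ, ∀ᵐ ω ∂P, perpetualIntegral f x B ω = c) ∧
      MemLp (perpetualIntegral f x B) 2 P ∧
      0 < Var[perpetualIntegral f x B; P]) := by
  obtain ⟨M, hM⟩ := hf_bdd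
  obtain ⟨B', hBm, hBc, hBB'⟩ := hB.exists_continuous_version
  have hB' := hB.congr hBB'
  have hI : perpetualIntegral f x B =ᵐ[P] perpetualIntegral f x B' := by
    filter_upwards [hBB'] with ω hω
    simp only [perpetualIntegral, hω]
  have hL2 : MemLp (perpetualIntegral f x B) 2 P :=
    (hB'.memLp_perpetualIntegral hBm hBc hH0 hH1 hd hf_cont hM hf_int).ae_eq hI.symm
  have hnc : f ≠ 0 → ¬ ∃ c : ℝ, ∀ᵐ ω ∂P, perpetualIntegral f x B ω = c := by
    rintro hf ⟨c, hc⟩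
    refine hf (hB'.eq_zero_of_ae_eq_const (x := x) (c := c) hBm hBc hH0 hH1 hd hf_cont hM hf_int ?_)
    filter_upwards [hI, hc] with ω h1 h2
    rw [← h1, h2]
  refine ⟨?_, ?_, hB.integrable_riesz hH0 hH1 hd hf_cont hM hf_int, ?_, fun hf => ⟨hnc hf, hL2, ?_⟩⟩
  · have h := (hB'.integrable_prod (x := x) hBm hBc hH0 hH1 hd hf_cont hM hf_int).prod_left_ae
    filter_upwards [h, hBB'] with ω h1 h2
    simpa only [h2, IntegrableOn] using h1
  · exact hL2.integrable one_le_two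
  · rw [integral_congr_ae hI]
    exact hB'.integral_perpetualIntegral hBm hBc hH0 hH1 hd hf_cont hM hf_int
  · refine (variance_nonneg _ _).lt_of_ne fun h0 => hnc hf
      ⟨∫ ω, perpetualIntegral f x B ω ∂P, ?_⟩
    exact ae_eq_integral_of_variance_eq_zero hL2 h0.symm
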